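/- **Setting.** Let $n,k,m$ be positive integers with $n\ge k$, let $J=\{1,\dots,n\}$, and let $M\subset\mathbb C^n$ be open, with coordinates $z_i$ and coordinate vector fields $\partial_i=\partial/\partial z_i$. A *Frobenius like structure of order $(n,k,m)$* on $M$ is a tuple $(M,K,\nabla^K,C,S,\zeta,(J,\mathcal F))$ where * $K\to M$ is a holomorphic vector bundle of finite rank with a flat holomorphic connection $\nabla^K$; * $C:\mathcal O(K)\to\Omega^1_M\otimes\mathcal O(K)$ is an $\mathcal O_M$-linear map with $C_XC_Y=C_YC_X$ for all vector fields $X,Y$, and with $\nabla^K_{\partial_i}(C_{\partial_j})=\nabla^K_{\partial_j}(C_{\partial_i})$ for all $i,j\in J$; * $S:\mathcal O(K)^m\to\mathcal O_M$ is an $\mathcal O_M$-multilinear form that is $\nabla^K$-flat and Higgs field invariant, i.e. $S(C_Xs_1,s_2,\dots,s_m)=S(s_1,C_Xs_2,\dots,s_m)=\dots=S(s_1,s_2,\dots,C_Xs_m)$; * $\zeta$ is a global nowhere vanishing holomorphic section of $K$; * $(J,\mathcal F)$ is a matroid of rank $k$ on $J$, and for each base (maximal independent set) $I=\{i_1,\dots,i_k\}$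 the section $C_I\zeta:=C_{\partial_{i_1}}\cdots C_{\partial_{i_k}}\zeta$ is $\nabla^K$-flat. For $I=\{i_1,\dots,i_k\}\subset J$ put $\partial_I=\partial_{i_1}\cdots\partial_{i_k}$. A holomorphic function $Q$ on an open $U\subset M$ is a *potential of the first kind* on $U$ if $\partial_{I_1}\cdots\partial_{I_m}Q=S(C_{I_1}\zeta,\dots,C_{I_m}\zeta)$ on $U$ for all bases $I_1,\dots,I_m$. A holomorphic function $L$ on $U$ is a *potential of the second kind* on $U$ if $\partial_i\partial_{I_1}\cdots\partial_{I_m}L=S(C_{\partial_i}C_{I_1}\zeta,C_{I_2}\zeta,\dots,C_{I_m}\zeta)$ on $U$ for all bases $I_1,\dots,I_m$ and all $i\in J$. For a multi-index $T\in\mathbb Z_{\ge0}^J$ write $|T|=\sum_iT(i)$, $T!=\prod_iT(i)!$, $\partial_T=\prod_i\partial_i^{T(i)}$, $C_T=\prod_iC_{\partial_i}^{T(i)}$, $(z-x)^T=\prod_i(z_i-x_i)^{T(i)}$. Call $T$ a *strong $(mk+l)$-system* if it is the sum of the indicator functions of $m$ bases and of a multi-index $R$ with $|R|=l$. **Theorem.**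 For every Frobenius like structure of order $(n,k,m)$ and every $x\in M$ there is an open neighbourhood $U\subset M$ of $x$ on which a potential $Q$ of the first kind and a potential $L$ of the second kind exist. Moreover $Q$ and $L$ can be chosen as follows. 1. $Q$ is the polynomial $$Q(z)=\sum_{T}\frac1{T!}\,S(C_T\zeta,\zeta,\dots,\zeta)(x)\,z^T,$$ where $T$ runs through the strong $mk$-systems. 2. $L$ is the sum on $U$ of a convergent power series $L(z)=\sum_Ta_T(z-x)^T$ with $$a_T=\frac1{T!}\bigl(\partial_{T_1}S(C_{T_2}\zeta,\zeta,\dots,\zeta)\bigr)(x)$$ for every decomposition $T=T_1+T_2$ with $T_2$ a strong $(mk+1)$-system and $T_1\in\mathbb Z_{\ge0}^J$ (in particular the right-hand side does not depend on the decomposition), and $a_T=0$ if $T$ has no such decomposition. -/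

import Mathlib

open Bundle TopologicalSpace
open scoped Manifold ContDiff

noncomputable section

/-! ### Partial derivatives on `ℂⁿ` -/

/-- The partial derivative `∂_i f` of a function on `ℂⁿ`; its value at a point only depends on the
germ of `f` at that point. -/
def partialDeriv {n : ℕ} (i : Fin n) (f : (Fin n → ℂ) → ℂ) : (Fin n → ℂ) → ℂ :=
  fun z => fderiv ℂ f z (Pi.single i 1)

/-- `∂_{i₁} ⋯ ∂_{i_r} f` for a word `[i₁, …, i_r]`. -/
def partialWord {n : ℕ} (w : List (Fin n)) (f : (Fin n → ℂ) → ℂ) : (Fin n → ℂ) → ℂ :=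
  w.foldr partialDeriv f

/-- `∂_I f` for a finite set `I` of indices. The elements are taken in increasing order; for
holomorphic functions the order is irrelevant. -/
def partialSet {n : ℕ} (I : Finset (Fin n)) (f : (Fin n → ℂ) → ℂ) : (Fin n → ℂ) → ℂ :=
  partialWord (I.sort (· ≤ ·)) f

/-- `∂_{I₁} ⋯ ∂_{I_m} f` for a tuple of finite sets of indices. -/
def partialSets {n m : ℕ} (I : Fin m → Finset (Fin n)) (f : (Fin n → ℂ) → ℂ) :
    (Fin n → ℂ) → ℂ :=
  (List.ofFn I).foldr partialSet f

/-- The increasing word in which every `i` occurs `T i` times. -/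
def multiWord {n : ℕ} (T : Fin n →₀ ℕ) : List (Fin n) :=
  (Finsupp.toMultiset T).sort (· ≤ ·)

/-- `∂_T f` for a multi-index `T`. -/
def partialMulti {n : ℕ} (T : Fin n →₀ ℕ) (f : (Fin n → ℂ) → ℂ) : (Fin n → ℂ) → ℂ :=
  partialWord (multiWord T) f

/-- `T! = ∏ T(i)!`. -/
def multiFactorial {n : ℕ} (T : Fin n →₀ ℕ) : ℕ :=
  ∏ i, (T i).factorial

/-- `(z - x)^T = ∏ (z_i - x_i)^{T(i)}`. -/
def multiPow {n : ℕ} (z x : Fin n → ℂ) (T : Fin n →₀ ℕ) : ℂ :=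
  ∏ i, (z i - x i) ^ T i

/-! ### Strong systems -/

/-- The multi-index of a finite set. -/
def setIndex {n : ℕ} (I : Finset (Fin n)) : Fin n →₀ ℕ :=
  ∑ i ∈ I, Finsupp.single i 1

/-- `T` is the sum of (the multi-indices of) `m` bases of the matroid and of an arbitrary
multi-index of degree `l`. -/
def IsStrongSystem {n : ℕ} (N : Matroid (Fin n)) (m l : ℕ) (T : Fin n →₀ ℕ) : Prop :=
  ∃ (I : Fin m → Finset (Fin n)) (R : Fin n →₀ ℕ), (∀ j, N.IsBase (I j : Set (Fin n))) ∧
    R.degree = l ∧ T = ∑ j, setIndex (I j) + R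

/-! ### Holomorphic bundles with connection over an open subset of `ℂⁿ` -/

/-- The coordinate vector field `∂_i` on an open subset of `ℂⁿ`. -/
def coordField {n : ℕ} {M : Opens (Fin n → ℂ)} (i : Fin n) (x : M) :
    TangentSpace 𝓘(ℂ, Fin n → ℂ) x :=
  (Pi.single i 1 : Fin n → ℂ)

section Bundle

variable {n : ℕ} {M : Opens (Fin n → ℂ)}
  (F : Type*) [NormedAddCommGroup F] [NormedSpace ℂ F]
  {K : M → Type*} [TopologicalSpace (TotalSpace F K)]
  [∀ x, AddCommGroup (K x)] [∀ x, Module ℂ (K x)] [∀ x, TopologicalSpace (K x)]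
  [∀ x, IsTopologicalAddGroup (K x)] [∀ x, ContinuousSMul ℂ (K x)]
  [FiberBundle F K] [VectorBundle ℂ F K]

/-- The section `σ` of `K` is holomorphic on `U`. -/
def IsHolSectionOn (σ : Π x : M, K x) (U : Set M) : Prop :=
  ContMDiffOn 𝓘(ℂ, Fin n → ℂ) (𝓘(ℂ, Fin n → ℂ).prod 𝓘(ℂ, F)) ω
    (fun x => TotalSpace.mk' F x (σ x)) U

variable {F}

/-- `∇_{∂_i} σ`. -/
def covCoord (D : CovariantDerivative 𝓘(ℂ, Fin n → ℂ) F K) (i : Fin n) (σ : Π x : M, K x) :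
    Π x : M, K x :=
  fun x => D σ x (coordField i x)

/-- `C_{i₁} ⋯ C_{i_r} : K_x → K_x` for a word `[i₁, …, i_r]`, where `C_i = C_{∂_i}`. -/
def higgsWord (C : Π x : M, TangentSpace 𝓘(ℂ, Fin n → ℂ) x →L[ℂ] K x →L[ℂ] K x)
    (w : List (Fin n)) (x : M) : K x →L[ℂ] K x :=
  (w.map fun i => C x (coordField i x)).prod

/-- `C_I` for a finite set `I` of indices (the order is irrelevant if the `C_{∂_i}` commute). -/
def higgsSet (C : Π x : M, TangentSpace 𝓘(ℂ, Fin n → ℂ) x →L[ℂ] K x →L[ℂ] K x)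
    (I : Finset (Fin n)) (x : M) : K x →L[ℂ] K x :=
  higgsWord C (I.sort (· ≤ ·)) x

/-- `C_T` for a multi-index `T`. -/
def higgsMulti (C : Π x : M, TangentSpace 𝓘(ℂ, Fin n → ℂ) x →L[ℂ] K x →L[ℂ] K x)
    (T : Fin n →₀ ℕ) (x : M) : K x →L[ℂ] K x :=
  higgsWord C (multiWord T) x

end Bundle

/-- A Frobenius like structure of order `(n, k, m)` on the vector bundle `K` over the open set
`M ⊆ ℂⁿ`. Conditions on the sheaf of holomorphic sections are imposed on the holomorphic sections
over all open subsets `U` of `M`; a 1-form is holomorphic iff its values on the coordinate vector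
fields `∂_i` are. -/
structure FrobeniusLikeStructure {n : ℕ} (k m : ℕ) (M : Opens (Fin n → ℂ))
    (F : Type*) [NormedAddCommGroup F] [NormedSpace ℂ F]
    (K : M → Type*) [TopologicalSpace (TotalSpace F K)]
    [∀ x, AddCommGroup (K x)] [∀ x, Module ℂ (K x)] [∀ x, TopologicalSpace (K x)]
    [∀ x, IsTopologicalAddGroup (K x)] [∀ x, ContinuousSMul ℂ (K x)]
    [FiberBundle F K] [VectorBundle ℂ F K] where
  /-- the connection `∇^K` -/
  conn : CovariantDerivative 𝓘(ℂ, Fin n → ℂ) F K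
  /-- the Higgs field -/
  C : Π x : M, TangentSpace 𝓘(ℂ, Fin n → ℂ) x →L[ℂ] K x →L[ℂ] K x
  /-- the `m`-linear form -/
  S : Π x : M, MultilinearMap ℂ (fun _ : Fin m => K x) ℂ
  /-- the distinguished section -/
  ζ : Π x : M, K x
  /-- the matroid -/
  matroid : Matroid (Fin n)
  /-- the connection is holomorphic -/
  conn_hol : ∀ (U : Opens M) (σ : Π x : M, K x), IsHolSectionOn F σ U →
    ∀ i, IsHolSectionOn F (covCoord conn i σ) U
  /-- the connection is flat -/
  conn_flat : ∀ (U : Opens M) (σ : Π x : M, K x), IsHolSectionOn F σ U → ∀ i j, ∀ x ∈ U,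
    covCoord conn i (covCoord conn j σ) x = covCoord conn j (covCoord conn i σ) x
  /-- the Higgs field is holomorphic -/
  C_hol : ∀ (U : Opens M) (σ : Π x : M, K x), IsHolSectionOn F σ U →
    ∀ i, IsHolSectionOn F (fun x => C x (coordField i x) (σ x)) U
  /-- the endomorphisms `C_X` commute -/
  C_comm : ∀ (x : M) (X Y : TangentSpace 𝓘(ℂ, Fin n → ℂ) x), C x X * C x Y = C x Y * C x X
  /-- the integrability condition `∇_{∂_i}(C_{∂_j}) = ∇_{∂_j}(C_{∂_i})` -/
  integrable : ∀ (U : Opens M) (σ : Π x : M, K x), IsHolSectionOn F σ U → ∀ i j, ∀ x ∈ U,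
    covCoord conn i (fun y => C y (coordField j y) (σ y)) x
        - C x (coordField j x) (covCoord conn i σ x) =
      covCoord conn j (fun y => C y (coordField i y) (σ y)) x
        - C x (coordField i x) (covCoord conn j σ x)
  /-- `S` is holomorphic -/
  S_hol : ∀ (U : Opens M) (σ : Fin m → Π x : M, K x), (∀ a, IsHolSectionOn F (σ a) U) →
    ContMDiffOn 𝓘(ℂ, Fin n → ℂ) 𝓘(ℂ) ω (fun x => S x fun a => σ a x) U
  /-- `S` is flat -/
  S_flat : ∀ (U : Opens M) (σ : Fin m → Π x : M, K x), (∀ a, IsHolSectionOn F (σ a) U) →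
    ∀ i, ∀ x ∈ U, mfderiv 𝓘(ℂ, Fin n → ℂ) 𝓘(ℂ) (fun y => S y fun a => σ a y) x (coordField i x) =
      ∑ a, S x (Function.update (fun b => σ b x) a (covCoord conn i (σ a) x))
  /-- `S` is Higgs field invariant -/
  S_higgs : ∀ (x : M) (X : TangentSpace 𝓘(ℂ, Fin n → ℂ) x) (s : Fin m → K x) (a b : Fin m),
    S x (Function.update s a (C x X (s a))) = S x (Function.update s b (C x X (s b)))
  /-- `ζ` is holomorphic -/
  ζ_hol : IsHolSectionOn F ζ Set.univ
  /-- `ζ` vanishes nowhere -/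
  ζ_ne_zero : ∀ x, ζ x ≠ 0
  /-- the ground set of the matroid is `J = {1, …, n}` -/
  matroid_ground : matroid.E = Set.univ
  /-- the matroid has rank `k` -/
  matroid_rank : matroid.eRank = k
  /-- `C_I ζ` is flat for every base `I` of the matroid -/
  flat_base : ∀ I : Finset (Fin n), matroid.IsBase (I : Set (Fin n)) →
    ∀ x, conn (fun y => higgsSet C I y (ζ y)) x = 0

namespace FrobeniusLikeStructure

variable {n k m : ℕ} {M : Opens (Fin n → ℂ)}
  {F : Type*} [NormedAddCommGroup F] [NormedSpace ℂ F]
  {K : M → Type*} [TopologicalSpace (TotalSpace F K)]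
  [∀ x, AddCommGroup (K x)] [∀ x, Module ℂ (K x)] [∀ x, TopologicalSpace (K x)]
  [∀ x, IsTopologicalAddGroup (K x)] [∀ x, ContinuousSMul ℂ (K x)]
  [FiberBundle F K] [VectorBundle ℂ F K]
  (D : FrobeniusLikeStructure k m M F K)

/-- `Q` is a potential of the first kind on the open set `U ⊆ M`. -/
def IsPotentialFirstKind (U : Opens (Fin n → ℂ)) (Q : (Fin n → ℂ) → ℂ) : Prop :=
  AnalyticOnNhd ℂ Q U ∧
    ∀ I : Fin m → Finset (Fin n), (∀ j, D.matroid.IsBase (I j : Set (Fin n))) →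
      ∀ z : M, (z : Fin n → ℂ) ∈ U →
        partialSets I Q z = D.S z fun j => higgsSet D.C (I j) z (D.ζ z)

/-- `L` is a potential of the second kind on the open set `U ⊆ M`. -/
def IsPotentialSecondKind [NeZero m] (U : Opens (Fin n → ℂ)) (L : (Fin n → ℂ) → ℂ) : Prop :=
  AnalyticOnNhd ℂ L U ∧
    ∀ I : Fin m → Finset (Fin n), (∀ j, D.matroid.IsBase (I j : Set (Fin n))) →
      ∀ i : Fin n, ∀ z : M, (z : Fin n → ℂ) ∈ U →
        partialDeriv i (partialSets I L) z =
          D.S z (Function.update (fun j => higgsSet D.C (I j) z (D.ζ z)) 0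
            (D.C z (coordField i z) (higgsSet D.C (I 0) z (D.ζ z))))

/-- The function `S(C_T ζ, ζ, …, ζ)` on `M`. -/
def matrixElement [NeZero m] (T : Fin n →₀ ℕ) (z : M) : ℂ :=
  D.S z (Function.update (fun _ => D.ζ z) 0 (higgsMulti D.C T z (D.ζ z)))

open Classical in
/-- The polynomial `∑_T (1 / T!) S(C_T ζ, ζ, …, ζ)(x) z^T`, where `T` runs through all sums of `m`
bases. -/
def firstKindPolynomial [NeZero m] (x : M) : MvPolynomial (Fin n) ℂ :=
  ∑ T ∈ (Finset.univ.finsuppAntidiag (m * k)).filter (IsStrongSystem D.matroid m 0),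
    MvPolynomial.monomial T ((multiFactorial T : ℂ)⁻¹ * D.matrixElement T x)

/-- The number `(1 / (T₁ + T₂)!) (∂_{T₁} S(C_{T₂} ζ, ζ, …, ζ))(x)`. To differentiate it, the
function on `M` is extended by zero to `ℂⁿ`. -/
def secondKindCoeff [NeZero m] (x : M) (T₁ T₂ : Fin n →₀ ℕ) : ℂ :=
  (multiFactorial (T₁ + T₂) : ℂ)⁻¹ *
    partialMulti T₁ (Function.extend Subtype.val (D.matrixElement T₂) 0) x

end FrobeniusLikeStructure

end

/-!
By Higgs invariance, `S(C_{I₁}ζ, …, C_{I_m}ζ) = S(C_Tζ, ζ, …, ζ)`, where `T` is the sum of the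
multi-indices of the bases `I_a`, so both kinds of potentials are common antiderivatives of the
functions `f_T = S(C_Tζ, ζ, …, ζ)` with `T` a strong system.

For a sum `A` of `m` bases, the sections `C_{I_a}ζ` are flat, hence `f_A` is locally constant and
the homogeneous polynomial `Q` works. The integrability of the Higgs field gives
`∂_i f_{A + e_j} = ∂_j f_{A + e_i}`, which is the compatibility condition for two strong
`(mk + 1)`-systems that differ by one exchange. Sums of `m` bases of a matroid form an M-convex set;
therefore any two decompositions `T₁ + T₂ = T₁' + T₂'` are connected by such exchanges, all inside
`T₁ + T₂`, and the Taylor coefficients of the functions `f_T` are those of a single power series.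
-/

open Filter
open scoped Pointwise Topology

section MConvex

variable {α : Type*} {B : Set (α →₀ ℕ)}

/-- M-convexity of a set of multi-indices: Murota's basis exchange axiom, in its one-sided form. The
exchanged point `x - e_i + e_j` is the `z` with `z + e_i = x + e_j`, which avoids truncated
subtraction. -/
def IsMConvex (B : Set (α →₀ ℕ)) : Prop :=
  ∀ ⦃x⦄, x ∈ B → ∀ ⦃y⦄, y ∈ B → ∀ i, y i < x i →
    ∃ j, x j < y j ∧ ∃ z ∈ B, z + Finsupp.single i 1 = x + Finsupp.single j 1

theorem degree_tsub_lt_of_exchange {x y z : α →₀ ℕ} {i j : α} (hi : y i < x i) (hj : x j < y j)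
    (hz : z + Finsupp.single i 1 = x + Finsupp.single j 1) :
    (z - y).degree < (x - y).degree := by
  classical
  have hij : i ≠ j := by rintro rfl; omega
  have h : z - y + Finsupp.single i 1 = x - y := by
    ext p
    have hp := DFunLike.congr_fun hz p
    simp only [Finsupp.add_apply, Finsupp.single_apply, Finsupp.tsub_apply] at hp ⊢
    split_ifs at hp ⊢ with hip hjp hjp <;> subst_vars <;> omega
  rw [← h, map_add, Finsupp.degree_single]
  exact Nat.lt_succ_self _

theorem sum_update_add_eq {ι A : Type*} [Fintype ι] [DecidableEq ι] [AddCommMonoid A] {b : ι → A}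
    {k : ι} {u s t : A} (h : u + s = b k + t) :
    ∑ l, Function.update b k u l + s = ∑ l, b l + t := by
  rw [Finset.sum_update_of_mem (Finset.mem_univ k), add_right_comm, h, add_right_comm,
    Finset.sdiff_singleton_eq_erase, Finset.add_sum_erase _ _ (Finset.mem_univ k)]

theorem sum_degree_tsub_update_lt {ι : Type*} [Fintype ι] [DecidableEq ι] {b b' : ι → α →₀ ℕ}
    {k : ι} {z : α →₀ ℕ} (h : (z - b' k).degree < (b k - b' k).degree) :
    ∑ l, (Function.update b k z l - b' l).degree < ∑ l, (b l - b' l).degree := by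
  refine Finset.sum_lt_sum (fun l _ => ?_) ⟨k, Finset.mem_univ k, by rwa [Function.update_self]⟩
  rcases eq_or_ne l k with rfl | hl
  · rw [Function.update_self]
    exact h.le
  · rw [Function.update_of_ne hl]

/-- Exchanging `i` for `j` in one summand either is an exchange of the required kind, or makes `j`
an element in excess and brings the summands closer to those of the target. -/
theorem IsMConvex.sum {ι : Type*} [Fintype ι] {B : ι → Set (α →₀ ℕ)}
    (hB : ∀ k, IsMConvex (B k)) : IsMConvex (∑ k, B k) := by
  classical
  intro x hx y hy i hi
  obtain ⟨b, hb, rfl⟩ := (Set.mem_fintype_sum _ _).1 hx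
  obtain ⟨b', hb', rfl⟩ := (Set.mem_fintype_sum _ _).1 hy
  clear hx hy
  induction hd : ∑ k, (b k - b' k).degree using Nat.strong_induction_on generalizing b i with
  | _ d ih =>
    obtain ⟨k, -, hk⟩ : ∃ k ∈ Finset.univ, b' k i < b k i :=
      Finset.exists_lt_of_sum_lt (by simpa only [Finsupp.finsetSum_apply] using hi)
    obtain ⟨j, hj, z, hz, hzb⟩ := hB k (hb k) (hb' k) i hk
    let b₁ := Function.update b k z
    have hb₁ : ∀ l, b₁ l ∈ B l :=
      (Function.forall_update_iff b fun l v => v ∈ B l).2 ⟨hz, fun l _ => hb l⟩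
    have hsum : ∑ l, b₁ l + Finsupp.single i 1 = ∑ l, b l + Finsupp.single j 1 :=
      sum_update_add_eq hzb
    have happ (p : α) := DFunLike.congr_fun hsum p
    simp only [Finsupp.add_apply, Finsupp.single_apply] at happ
    have hij : i ≠ j := by rintro rfl; omega
    rcases lt_or_ge ((∑ l, b l) j) ((∑ l, b' l) j) with hlt | hge
    · exact ⟨j, hlt, _, (Set.mem_fintype_sum _ _).2 ⟨b₁, hb₁, rfl⟩, hsum⟩
    have hj₁ : (∑ l, b' l) j < (∑ l, b₁ l) j := by
      have := happ j
      simp only [if_neg hij, if_true] at this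
      omega
    have hd₁ : ∑ l, (b₁ l - b' l).degree < d :=
      hd ▸ sum_degree_tsub_update_lt (degree_tsub_lt_of_exchange hk hj hzb)
    obtain ⟨w, hw, u, hu, huw⟩ := ih _ hd₁ j b₁ hb₁ hj₁ rfl
    refine ⟨w, ?_, u, hu, ?_⟩
    · have := happ w
      split_ifs at this <;> subst_vars <;> omega
    · refine add_right_cancel (b := Finsupp.single j 1) ?_
      rw [add_right_comm, huw, add_right_comm, hsum, add_right_comm]

/-- Any two points of an M-convex set below `T` are joined by exchanges inside `T`. -/
theorem IsMConvex.induction (hB : IsMConvex B) {T : α →₀ ℕ} {P : (α →₀ ℕ) → Prop}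
    (hP : ∀ x ∈ B, ∀ z ∈ B, ∀ i j, z + Finsupp.single i 1 = x + Finsupp.single j 1 →
      x + Finsupp.single j 1 ≤ T → P z → P x)
    {x y : α →₀ ℕ} (hx : x ∈ B) (hy : y ∈ B) (hxT : x ≤ T) (hyT : y ≤ T) (h : P y) : P x := by
  classical
  induction hd : (x - y).degree using Nat.strong_induction_on generalizing x with
  | _ d ih =>
    by_cases hxy : x ≤ y
    · have hyx : y ≤ x := by
        intro i
        by_contra! hi
        obtain ⟨j, hj, -⟩ := hB hy hx i hi
        exact (hxy j).not_gt hj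
      rwa [le_antisymm hxy hyx]
    obtain ⟨i, hi⟩ : ∃ i, y i < x i := by simpa only [Finsupp.le_def, not_forall, not_le] using hxy
    obtain ⟨j, hj, z, hz, hzx⟩ := hB hx hy i hi
    have hxjT : x + Finsupp.single j 1 ≤ T := by
      intro p
      rw [Finsupp.add_apply, Finsupp.single_apply]
      have := hxT p
      have := hyT p
      split_ifs <;> subst_vars <;> omega
    refine hP x hx z hz i j hzx hxjT (ih _ ?_ hz ?_ rfl)
    · rw [← hd]
      exact degree_tsub_lt_of_exchange hi hj hzx
    · exact (le_self_add.trans hzx.le).trans hxjT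

end MConvex

section StrongSystem

variable {n m l : ℕ} {N : Matroid (Fin n)} {T : Fin n →₀ ℕ}

theorem setIndex_apply (I : Finset (Fin n)) (i : Fin n) :
    setIndex I i = if i ∈ I then 1 else 0 := by
  simp only [setIndex, Finsupp.finsetSum_apply, Finsupp.single_apply, Finset.sum_ite_eq']

theorem degree_setIndex (I : Finset (Fin n)) : (setIndex I).degree = I.card := by
  simp only [setIndex, map_sum, Finsupp.degree_single, Finset.sum_const, smul_eq_mul, mul_one]

theorem isMConvex_setIndex_isBase (N : Matroid (Fin n)) :
    IsMConvex (setIndex '' {I : Finset (Fin n) | N.IsBase (I : Set (Fin n))}) := by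
  rintro _ ⟨I, hI, rfl⟩ _ ⟨I', hI', rfl⟩ i hi
  have hiI : i ∈ I ∧ i ∉ I' := by grind [setIndex_apply]
  obtain ⟨j, ⟨hjI', hjI⟩, hB⟩ := hI.exchange hI' hiI
  rw [Finset.mem_coe] at hjI' hjI
  refine ⟨j, by simp only [setIndex_apply, hjI, hjI', if_true, if_false, zero_lt_one],
    setIndex (insert j (I.erase i)), ⟨_, by simpa using hB, rfl⟩, ?_⟩
  have hj : j ∉ I.erase i := fun h => hjI (Finset.mem_of_mem_erase h)
  rw [setIndex, Finset.sum_insert hj, add_assoc, Finset.sum_erase_add _ _ hiI.1, add_comm, setIndex]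

theorem isStrongSystem_zero_iff : IsStrongSystem N m 0 T ↔
    ∃ I : Fin m → Finset (Fin n), (∀ j, N.IsBase (I j : Set (Fin n))) ∧
      T = ∑ j, setIndex (I j) := by
  simp only [IsStrongSystem, Finsupp.degree_eq_zero_iff, exists_eq_left, exists_and_left, add_zero]

theorem isStrongSystem_iff_exists_add : IsStrongSystem N m l T ↔
    ∃ A, IsStrongSystem N m 0 A ∧ ∃ R : Fin n →₀ ℕ, R.degree = l ∧ T = A + R := by
  constructor
  · rintro ⟨I, R, hI, hR, rfl⟩
    exact ⟨_, isStrongSystem_zero_iff.2 ⟨I, hI, rfl⟩, R, hR, rfl⟩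
  · rintro ⟨A, hA, R, hR, rfl⟩
    obtain ⟨I, hI, rfl⟩ := isStrongSystem_zero_iff.1 hA
    exact ⟨I, R, hI, hR, rfl⟩

theorem isStrongSystem_one_iff : IsStrongSystem N m 1 T ↔
    ∃ A, IsStrongSystem N m 0 A ∧ ∃ i, T = A + Finsupp.single i 1 := by
  rw [isStrongSystem_iff_exists_add]
  refine exists_congr fun A => and_congr_right fun _ => ⟨?_, ?_⟩
  · rintro ⟨R, hR, rfl⟩
    obtain ⟨s, rfl⟩ := Multiset.toFinsupp.surjective R
    obtain ⟨i, rfl⟩ := Multiset.card_eq_one.1 ((Multiset.toFinsupp_sum_eq s).symm.trans hR)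
    exact ⟨i, by rw [Multiset.toFinsupp_singleton]⟩
  · rintro ⟨i, rfl⟩
    exact ⟨_, Finsupp.degree_single i 1, rfl⟩

theorem isMConvex_setOf_isStrongSystem_zero (N : Matroid (Fin n)) (m : ℕ) :
    IsMConvex {T | IsStrongSystem N m 0 T} := by
  convert IsMConvex.sum fun _ : Fin m => isMConvex_setIndex_isBase N using 1
  ext T
  rw [Set.mem_ofPred_eq, isStrongSystem_zero_iff, Set.mem_fintype_sum]
  constructor
  · rintro ⟨I, hI, rfl⟩
    exact ⟨_, fun j => ⟨I j, hI j, rfl⟩, rfl⟩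
  · rintro ⟨b, hb, rfl⟩
    choose I hI hb using hb
    exact ⟨I, hI, by simp only [hb]⟩

theorem IsStrongSystem.degree_eq {k : ℕ} (hk : N.eRank = k) (hT : IsStrongSystem N m l T) :
    T.degree = m * k + l := by
  obtain ⟨I, R, hI, rfl, rfl⟩ := hT
  have hcard (j : Fin m) : (I j).card = k := by
    have h := (hI j).encard_eq_eRank
    rwa [hk, Set.encard_coe_eq_coe_finsetCard, Nat.cast_inj] at h
  simp only [map_add, map_sum, degree_setIndex, hcard, Finset.sum_const, Finset.card_univ,
    Fintype.card_fin, smul_eq_mul]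

theorem finite_setOf_isStrongSystem {k : ℕ} (hk : N.eRank = k) (m l : ℕ) :
    {T | IsStrongSystem N m l T}.Finite :=
  (Finsupp.finite_of_degree_eq (m * k + l)).subset fun _ hT => hT.degree_eq hk

end StrongSystem

noncomputable section

section MultiSeries

variable {n : ℕ}

/-- The multi-index of a word: the number of occurrences of each letter. -/
def wordIndex (w : List (Fin n)) : Fin n →₀ ℕ :=
  Multiset.toFinsupp (w : Multiset (Fin n))

theorem wordIndex_nil : wordIndex ([] : List (Fin n)) = 0 :=
  map_zero _

theorem wordIndex_append (v w : List (Fin n)) :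
    wordIndex (v ++ w) = wordIndex v + wordIndex w := by
  rw [wordIndex, ← Multiset.coe_add, map_add, wordIndex, wordIndex]

theorem wordIndex_singleton (i : Fin n) : wordIndex [i] = Finsupp.single i 1 := by
  rw [wordIndex, Multiset.coe_singleton, Multiset.toFinsupp_singleton]

theorem wordIndex_cons (i : Fin n) (w : List (Fin n)) :
    wordIndex (i :: w) = Finsupp.single i 1 + wordIndex w := by
  rw [← List.singleton_append, wordIndex_append, wordIndex_singleton]

theorem wordIndex_multiWord (T : Fin n →₀ ℕ) : wordIndex (multiWord T) = T := by
  rw [wordIndex, multiWord, Multiset.sort_eq, Finsupp.toMultiset_toFinsupp]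

theorem degree_wordIndex (w : List (Fin n)) : (wordIndex w).degree = w.length := by
  rw [← Multiset.coe_card]
  exact Multiset.toFinsupp_sum_eq (w : Multiset (Fin n))

theorem multiWord_setIndex (I : Finset (Fin n)) : multiWord (setIndex I) = I.sort (· ≤ ·) := by
  have h : Finsupp.toMultiset (setIndex I) = I.val := by
    simp only [setIndex, map_sum, Finsupp.toMultiset_single, one_nsmul,
      Finset.sum_multiset_singleton]
  rw [multiWord, h, Finset.sort_val]

theorem prod_map_eq_prod_pow (w : List (Fin n)) (y : Fin n → ℂ) :
    (w.map y).prod = ∏ i, y i ^ wordIndex w i := by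
  induction w with
  | nil => simp only [List.map_nil, List.prod_nil, wordIndex_nil, Finsupp.coe_zero, Pi.zero_apply,
      pow_zero, Finset.prod_const_one]
  | cons i w ih =>
    have h : y i = ∏ j, y j ^ Finsupp.single i 1 j := by
      simp only [Finsupp.single_apply, pow_ite, pow_one, pow_zero, Finset.prod_ite_eq,
        Finset.mem_univ, if_true]
    simp only [List.map_cons, List.prod_cons, ih, wordIndex_cons, Finsupp.add_apply, pow_add,
      Finset.prod_mul_distrib, ← h]

theorem multiFactorial_zero : multiFactorial (0 : Fin n →₀ ℕ) = 1 :=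
  Finset.prod_eq_one fun _ _ => Nat.factorial_zero

theorem multiFactorial_ne_zero (T : Fin n →₀ ℕ) : (multiFactorial T : ℂ) ≠ 0 :=
  Nat.cast_ne_zero.2 (Finset.prod_ne_zero_iff.2 fun _ _ => Nat.factorial_ne_zero _)

theorem multiFactorial_add_single (T : Fin n →₀ ℕ) (i : Fin n) :
    multiFactorial (T + Finsupp.single i 1) = (T i + 1) * multiFactorial T := by
  rw [multiFactorial, multiFactorial, ← Finset.mul_prod_erase _ _ (Finset.mem_univ i),
    ← Finset.mul_prod_erase _ (fun j => (T j).factorial) (Finset.mem_univ i), ← mul_assoc]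
  congr 1
  · rw [Finsupp.add_apply, Finsupp.single_eq_same, Nat.factorial_succ]
  · refine Finset.prod_congr rfl fun j hj => ?_
    rw [Finsupp.add_apply, Finsupp.single_eq_of_ne (Finset.ne_of_mem_erase hj), add_zero]

theorem multiPow_add (z x : Fin n → ℂ) (S T : Fin n →₀ ℕ) :
    multiPow z x (S + T) = multiPow z x S * multiPow z x T := by
  simp only [multiPow, Finsupp.add_apply, pow_add, Finset.prod_mul_distrib]

theorem multiPow_zero (z x : Fin n → ℂ) : multiPow z x 0 = 1 :=
  Finset.prod_eq_one fun _ _ => pow_zero _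

theorem multiPow_self {x : Fin n → ℂ} {T : Fin n →₀ ℕ} (hT : T ≠ 0) : multiPow x x T = 0 := by
  obtain ⟨i, hi⟩ := Finsupp.ne_iff.1 hT
  exact Finset.prod_eq_zero (Finset.mem_univ i) (by rw [sub_self, zero_pow hi])

theorem norm_multiPow_le {z x : Fin n → ℂ} {r : ℝ} (h : dist z x ≤ r) (T : Fin n →₀ ℕ) :
    ‖multiPow z x T‖ ≤ r ^ T.degree := by
  rw [multiPow, norm_prod, Finsupp.degree_eq_sum, ← Finset.prod_pow_eq_pow_sum]
  refine Finset.prod_le_prod (fun _ _ => norm_nonneg _) fun i _ => ?_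
  rw [norm_pow, ← dist_eq_norm]
  exact pow_le_pow_left₀ dist_nonneg ((dist_le_pi_dist z x i).trans h) _

theorem tsum_degree_fiber {E : Type*} [NormedAddCommGroup E] (g : (Fin n →₀ ℕ) → E) (k : ℕ) :
    ∑' T : (Finsupp.degree ⁻¹' {k} : Set (Fin n →₀ ℕ)), g T =
      ∑ T ∈ Finset.univ.finsuppAntidiag k, g T := by
  have h : Finsupp.degree ⁻¹' {k} =
      ((Finset.univ.finsuppAntidiag k : Finset (Fin n →₀ ℕ)) : Set (Fin n →₀ ℕ)) := by
    ext T
    simp only [Set.mem_preimage, Set.mem_singleton_iff, Finsupp.degree_eq_sum, Finset.mem_coe,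
      Finset.mem_finsuppAntidiag, Finset.subset_univ, and_true]
  rw [h, Finset.tsum_subtype']

theorem exists_continuousMultilinearMap_apply_const_eq_prod (T : Fin n →₀ ℕ) (k : ℕ)
    (hk : T.degree = k) : ∃ q : ContinuousMultilinearMap ℂ (fun _ : Fin k => Fin n → ℂ) ℂ,
      ‖q‖ ≤ 1 ∧ ∀ y, q (fun _ => y) = ∏ i, y i ^ T i := by
  obtain ⟨w, rfl⟩ : ∃ w, wordIndex w = T := ⟨_, wordIndex_multiWord T⟩
  rw [degree_wordIndex] at hk
  subst hk
  refine ⟨(ContinuousMultilinearMap.mkPiAlgebra ℂ (Fin w.length) ℂ).compContinuousLinearMap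
    fun j => ContinuousLinearMap.proj w[j], ?_, fun y => ?_⟩
  · refine (ContinuousMultilinearMap.norm_compContinuousLinearMap_le _ _).trans ?_
    rw [ContinuousMultilinearMap.norm_mkPiAlgebra, one_mul]
    refine Finset.prod_le_one (fun _ _ => norm_nonneg _) fun j _ => ?_
    refine ContinuousLinearMap.opNorm_le_bound _ zero_le_one fun y => ?_
    rw [one_mul]
    exact norm_le_pi_norm y _
  · rw [← prod_map_eq_prod_pow, ← Fin.prod_univ_fun_getElem]
    rfl

theorem partialDeriv_eq_deriv_update {f : (Fin n → ℂ) → ℂ} {z : Fin n → ℂ}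
    (hf : DifferentiableAt ℂ f z) (i : Fin n) :
    partialDeriv i f z = deriv (fun t => f (Function.update z i t)) (z i) :=
  (HasFDerivAt.comp_hasDerivAt_of_eq (z i) hf.hasFDerivAt (hasDerivAt_update z i (z i))
    (Function.update_eq_self i z).symm).deriv.symm

theorem multiPow_update (z x : Fin n → ℂ) (i : Fin n) (t : ℂ) (T : Fin n →₀ ℕ) :
    multiPow (Function.update z i t) x T = (t - x i) ^ T i * multiPow z x (T.erase i) := by
  simp only [multiPow, ← Finset.mul_prod_erase _ _ (Finset.mem_univ i), Function.update_self,
    Finsupp.erase_same, pow_zero, one_mul]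
  congr 1
  refine Finset.prod_congr rfl fun j hj => ?_
  have hj := Finset.ne_of_mem_erase hj
  rw [Function.update_of_ne hj, Finsupp.erase_ne hj]

theorem deriv_multiPow_update (z x : Fin n → ℂ) (i : Fin n) (T : Fin n →₀ ℕ) :
    deriv (fun t => multiPow (Function.update z i t) x T) (z i) =
      T i * multiPow z x (T - Finsupp.single i 1) := by
  have herase : (T - Finsupp.single i 1).erase i = T.erase i := by
    ext j
    by_cases hj : j = i
    · rw [hj, Finsupp.erase_same, Finsupp.erase_same]
    · rw [Finsupp.erase_ne hj, Finsupp.erase_ne hj, Finsupp.tsub_apply,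
        Finsupp.single_eq_of_ne hj, tsub_zero]
  have hpow := multiPow_update z x i (z i) (T - Finsupp.single i 1)
  rw [Function.update_eq_self, herase, Finsupp.tsub_apply, Finsupp.single_eq_same] at hpow
  simp [multiPow_update, hpow, mul_assoc]

/-- On the polydisc of radius `r` around `x`, the function `f` is the sum of the power series with
coefficients `c`. -/
def HasMultiSeries (f : (Fin n → ℂ) → ℂ) (x : Fin n → ℂ) (c : (Fin n →₀ ℕ) → ℂ) (r : ℝ) : Prop :=
  ∀ z ∈ Metric.ball x r, HasSum (fun T => c T * multiPow z x T) (f z)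

namespace HasMultiSeries

variable {f g : (Fin n → ℂ) → ℂ} {x : Fin n → ℂ} {c d : (Fin n →₀ ℕ) → ℂ} {r s : ℝ}

theorem mono (h : HasMultiSeries f x c r) (hs : s ≤ r) : HasMultiSeries f x c s :=
  fun z hz => h z (Metric.ball_subset_ball hs hz)

theorem eqOn (hf : HasMultiSeries f x c r) (hg : HasMultiSeries g x c r) :
    Set.EqOn f g (Metric.ball x r) :=
  fun z hz => (hf z hz).unique (hg z hz)

theorem summable_norm (h : HasMultiSeries f x c r) (hs0 : 0 ≤ s) (hs : s < r) :
    Summable fun T => ‖c T‖ * s ^ T.degree := by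
  have hz : (fun i => x i + s) ∈ Metric.ball x r := by
    refine lt_of_le_of_lt ((dist_pi_le_iff hs0).2 fun i => ?_) hs
    rw [dist_self_add_left, Complex.norm_of_nonneg hs0]
  convert (h _ hz).summable.norm using 2 with T
  simp only [norm_mul, multiPow, norm_prod, Finsupp.degree_eq_sum, ← Finset.prod_pow_eq_pow_sum,
    add_sub_cancel_left, norm_pow, Complex.norm_of_nonneg hs0]

theorem apply_center (h : HasMultiSeries f x c r) (hr : 0 < r) : f x = c 0 := by
  refine (h x (Metric.mem_ball_self hr)).unique ?_
  convert hasSum_single (0 : Fin n →₀ ℕ) fun T hT => ?_ using 1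
  · rw [multiPow_zero, mul_one]
  · rw [multiPow_self hT, mul_zero]

theorem exists_hasFPowerSeriesOnBall (h : HasMultiSeries f x c r) (hs0 : 0 < s) (hsr : s < r) :
    ∃ p : FormalMultilinearSeries ℂ (Fin n → ℂ) ℂ,
      HasFPowerSeriesOnBall f p x (ENNReal.ofReal s) := by
  choose! q hq_norm hq_apply using
    exists_continuousMultilinearMap_apply_const_eq_prod (n := n)
  have hdeg {k : ℕ} {T : Fin n →₀ ℕ} (hT : T ∈ Finset.univ.finsuppAntidiag k) : T.degree = k := by
    rw [Finsupp.degree_eq_sum]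
    exact (Finset.mem_finsuppAntidiag.1 hT).1
  let p : FormalMultilinearSeries ℂ (Fin n → ℂ) ℂ := fun k =>
    ∑ T ∈ Finset.univ.finsuppAntidiag k, c T • q T k
  refine ⟨p, ?_, ENNReal.ofReal_pos.2 hs0, fun {y} hy => ?_⟩
  · refine p.le_radius_of_summable_norm ?_
    rw [Real.coe_toNNReal _ hs0.le]
    refine Summable.of_nonneg_of_le (fun k => by positivity) (fun k => ?_)
      ((h.summable_norm hs0.le hsr).hasSum.tsum_fiberwise Finsupp.degree).summable
    rw [tsum_degree_fiber fun T => ‖c T‖ * s ^ T.degree]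
    refine (mul_le_mul_of_nonneg_right (norm_sum_le _ _) (by positivity)).trans ?_
    rw [Finset.sum_mul]
    refine Finset.sum_le_sum fun T hT => ?_
    rw [norm_smul, hdeg hT]
    gcongr
    exact mul_le_of_le_one_right (norm_nonneg _) (hq_norm T k (hdeg hT))
  · have hy' : x + y ∈ Metric.ball x r := by
      rw [Metric.mem_eball, edist_zero_right, ← ofReal_norm,
        ENNReal.ofReal_lt_ofReal_iff hs0] at hy
      rw [Metric.mem_ball, dist_self_add_left]
      exact hy.trans hsr
    convert (h _ hy').tsum_fiberwise Finsupp.degree using 2 with k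
    rw [tsum_degree_fiber fun T => c T * multiPow (x + y) x T]
    simp only [p, sum_apply, smul_apply, smul_eq_mul]
    refine Finset.sum_congr rfl fun T hT => ?_
    simp only [hq_apply T k (hdeg hT), multiPow, Pi.add_apply, add_sub_cancel_left]

theorem analyticOnNhd (h : HasMultiSeries f x c r) : AnalyticOnNhd ℂ f (Metric.ball x r) := by
  intro z hz
  obtain ⟨s, hzs, hsr⟩ := exists_between (Metric.mem_ball.1 hz)
  have hs0 : 0 < s := dist_nonneg.trans_lt hzs
  obtain ⟨p, hp⟩ := h.exists_hasFPowerSeriesOnBall hs0 hsr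
  refine hp.analyticAt_of_mem ?_
  rw [Metric.mem_eball, edist_dist]
  exact (ENNReal.ofReal_lt_ofReal_iff hs0).2 hzs

theorem hasSum_partialDeriv (h : HasMultiSeries f x c r) (i : Fin n) {z : Fin n → ℂ}
    (hz : z ∈ Metric.ball x r) :
    HasSum (fun T => c T * (T i * multiPow z x (T - Finsupp.single i 1))) (partialDeriv i f z) := by
  obtain ⟨s, hzs, hsr⟩ := exists_between (Metric.mem_ball.1 hz)
  have hcont : Continuous (Function.update z i) := continuous_const.update i continuous_id
  let V : Set ℂ := Function.update z i ⁻¹' Metric.ball x s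
  have hV : IsOpen V := Metric.isOpen_ball.preimage hcont
  have hzV : z i ∈ V := by
    rwa [Set.mem_preimage, Function.update_eq_self]
  have hdiff (T : Fin n →₀ ℕ) :
      DifferentiableOn ℂ (fun t => c T * multiPow (Function.update z i t) x T) V := by
    simp only [multiPow_update]
    fun_prop
  have hsum := Complex.hasSum_deriv_of_summable_norm
    (h.summable_norm (dist_nonneg.trans hzs.le) hsr) hdiff hV
    (fun T t ht => by
      rw [norm_mul]
      exact mul_le_mul_of_nonneg_left (norm_multiPow_le (le_of_lt ht) T) (norm_nonneg _)) hzV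
  have hf : (fun t => ∑' T, c T * multiPow (Function.update z i t) x T) =ᶠ[nhds (z i)]
      fun t => f (Function.update z i t) := by
    filter_upwards [hV.mem_nhds hzV] with t ht
    exact (h _ (Metric.ball_subset_ball hsr.le ht)).tsum_eq
  rw [hf.deriv_eq, ← partialDeriv_eq_deriv_update (h.analyticOnNhd z hz).differentiableAt] at hsum
  refine hsum.congr_fun fun T => ?_
  rw [deriv_const_mul_field, deriv_multiPow_update]

protected theorem partialDeriv (h : HasMultiSeries f x c r) (i : Fin n) :
    HasMultiSeries (partialDeriv i f) x (fun T => (T i + 1) * c (T + Finsupp.single i 1)) r := by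
  intro z hz
  have hsum := h.hasSum_partialDeriv i hz
  rw [← (add_left_injective (Finsupp.single i 1)).hasSum_iff fun T hT => ?_] at hsum
  · refine hsum.congr_fun fun T => ?_
    simp only [Function.comp_apply, add_tsub_cancel_right, Finsupp.add_apply,
      Finsupp.single_eq_same, Nat.cast_add, Nat.cast_one]
    ring
  · have hTi : T i = 0 := by
      by_contra hne
      exact hT ⟨T - Finsupp.single i 1, tsub_add_cancel_of_le
        (Finsupp.single_le_iff.2 (Nat.one_le_iff_ne_zero.2 hne))⟩
    rw [hTi, Nat.cast_zero, zero_mul, mul_zero]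

protected theorem partialWord (h : HasMultiSeries f x c r) (w : List (Fin n)) :
    HasMultiSeries (partialWord w f) x (fun T => (multiFactorial T : ℂ)⁻¹ *
      (multiFactorial (T + wordIndex w) * c (T + wordIndex w))) r := by
  induction w with
  | nil =>
    simpa only [partialWord, List.foldr_nil, wordIndex_nil, add_zero,
      inv_mul_cancel_left₀ (multiFactorial_ne_zero _)] using h
  | cons i w ih =>
    refine fun z hz => (ih.partialDeriv i z hz).congr_fun fun T => ?_
    beta_reduce
    rw [wordIndex_cons, ← add_assoc T, multiFactorial_add_single T i]
    have := multiFactorial_ne_zero T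
    have : (T i + 1 : ℂ) ≠ 0 := Nat.cast_add_one_ne_zero (T i)
    push_cast
    field_simp

protected theorem partialMulti (h : HasMultiSeries f x c r) (S : Fin n →₀ ℕ) :
    HasMultiSeries (partialMulti S f) x (fun T => (multiFactorial T : ℂ)⁻¹ *
      (multiFactorial (T + S) * c (T + S))) r := by
  simpa only [wordIndex_multiWord, partialMulti] using h.partialWord (multiWord S)

theorem partialMulti_center (h : HasMultiSeries f x c r) (hr : 0 < r) (T : Fin n →₀ ℕ) :
    partialMulti T f x = multiFactorial T * c T := by
  rw [(h.partialMulti T).apply_center hr, zero_add, multiFactorial_zero, Nat.cast_one, inv_one,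
    one_mul]

end HasMultiSeries

section Words

variable {k : ℕ} (q : ContinuousMultilinearMap ℂ (fun _ : Fin k => Fin n → ℂ) ℂ)

theorem apply_sub_eq_sum_words (z x : Fin n → ℂ) :
    q (fun _ => z - x) =
      ∑ w : Fin k → Fin n,
        q (fun j => Pi.single (w j) 1) * multiPow z x (wordIndex (List.ofFn w)) := by
  have hzx : z - x = ∑ i, (z - x) i • (Pi.single i (1 : ℂ) : Fin n → ℂ) := by
    simpa only [Algebra.smul_def] using pi_eq_sum_univ' (z - x)
  conv_lhs => rw [hzx, ContinuousMultilinearMap.map_sum]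
  refine Finset.sum_congr rfl fun w _ => ?_
  rw [ContinuousMultilinearMap.map_smul_univ, smul_eq_mul, mul_comm, ← List.prod_ofFn, multiPow,
    ← prod_map_eq_prod_pow _ fun i => z i - x i, List.map_ofFn]
  rfl

theorem norm_apply_single_le (w : Fin k → Fin n) : ‖q (fun j => Pi.single (w j) 1)‖ ≤ ‖q‖ := by
  refine (q.le_opNorm _).trans_eq ?_
  simp only [Pi.norm_single, norm_one, Finset.prod_const_one, mul_one]

theorem summable_norm_words {p : FormalMultilinearSeries ℂ (Fin n → ℂ) ℂ} {s : ℝ} {t : NNReal}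
    (hs : 0 ≤ s) (hst : n * s ≤ t) (ht : t < p.radius) :
    Summable fun b : Σ k, Fin k → Fin n =>
      ‖p b.1 (fun j => Pi.single (b.2 j) 1)‖ * s ^ b.1 := by
  refine Summable.of_nonneg_of_le (fun b => by positivity)
    (fun b => mul_le_mul_of_nonneg_right (norm_apply_single_le (p b.1) b.2) (by positivity))
    ((summable_sigma_of_nonneg fun b => by positivity).2 ⟨fun k => Summable.of_finite, ?_⟩)
  refine Summable.of_nonneg_of_le (fun k => tsum_nonneg fun _ => by positivity) (fun k => ?_)
    (p.summable_norm_mul_pow ht)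
  have : ∑' _ : Fin k → Fin n, ‖p k‖ * s ^ k = ‖p k‖ * (n * s) ^ k := by
    simp only [tsum_fintype, Finset.sum_const, Finset.card_univ, Fintype.card_fun, Fintype.card_fin,
      nsmul_eq_mul, mul_pow, Nat.cast_pow]
    ring
  rw [this]
  gcongr

end Words

theorem hasSum_words {f : (Fin n → ℂ) → ℂ} {p : FormalMultilinearSeries ℂ (Fin n → ℂ) ℂ}
    {x z : Fin n → ℂ} {R : ENNReal} (hp : HasFPowerSeriesOnBall f p x R) {t : NNReal} (htR : t < R)
    {s : ℝ} (hst : (n + 1) * s ≤ t) (hz : dist z x ≤ s) :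
    HasSum (fun b : Σ k, Fin k → Fin n => p b.1 (fun j => Pi.single (b.2 j) 1) *
      multiPow z x (wordIndex (List.ofFn b.2))) (f z) := by
  have hs0 : 0 ≤ s := dist_nonneg.trans hz
  have hzR : z - x ∈ Metric.eball (0 : Fin n → ℂ) R := by
    rw [Metric.mem_eball, edist_zero_right, ← ofReal_norm, ← dist_eq_norm]
    refine lt_of_le_of_lt (ENNReal.ofReal_le_ofReal (hz.trans ?_)) <|
      (ENNReal.ofReal_coe_nnreal (p := t)).trans_lt htR
    exact (le_mul_of_one_le_left hs0 (le_add_of_nonneg_left n.cast_nonneg)).trans hst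
  have h := hp.hasSum hzR
  rw [add_sub_cancel] at h
  refine h.sigma_of_hasSum (fun k => ?_) ?_
  · rw [apply_sub_eq_sum_words]
    exact hasSum_fintype _
  · have hns : n * s ≤ t := (mul_le_mul_of_nonneg_right (lt_add_one _).le hs0).trans hst
    refine Summable.of_norm_bounded (summable_norm_words hs0 hns (htR.trans_le hp.r_le))
      fun b => ?_
    have hpow := norm_multiPow_le hz (wordIndex (List.ofFn b.2))
    rw [degree_wordIndex, List.length_ofFn] at hpow
    rw [norm_mul]
    gcongr

theorem exists_hasMultiSeries {f : (Fin n → ℂ) → ℂ} {x : Fin n → ℂ} (hf : AnalyticAt ℂ f x) :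
    ∃ r > 0, ∃ c, HasMultiSeries f x c r := by
  obtain ⟨p, R, hp⟩ := hf
  obtain ⟨t, ht0, htR⟩ := ENNReal.lt_iff_exists_nnreal_btwn.1 hp.r_pos
  have hn : (0 : ℝ) < n + 1 := by positivity
  have hst : (n + 1) * (t / (n + 1) : ℝ) ≤ t := (mul_div_cancel₀ _ hn.ne').le
  let q (b : Σ k, Fin k → Fin n) : ℂ := p b.1 fun j => Pi.single (b.2 j) 1
  let idx (b : Σ k, Fin k → Fin n) : Fin n →₀ ℕ := wordIndex (List.ofFn b.2)
  refine ⟨t / (n + 1), div_pos (by exact_mod_cast ht0) hn, fun T => ∑' b : idx ⁻¹' {T}, q b,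
    fun z hz => ?_⟩
  refine ((hasSum_words hp htR hst (Metric.mem_ball.1 hz).le).tsum_fiberwise idx).congr_fun
    fun T => ?_
  rw [← tsum_mul_right]
  exact tsum_congr fun b => congrArg (q b * multiPow z x ·) (b.2 : idx b = T).symm

/-- The coefficient of `(z - x)^T` in the Taylor series of `f` at `x`. -/
def taylorCoeff (f : (Fin n → ℂ) → ℂ) (x : Fin n → ℂ) (T : Fin n →₀ ℕ) : ℂ :=
  (multiFactorial T : ℂ)⁻¹ * partialMulti T f x

section Analytic

variable {f g : (Fin n → ℂ) → ℂ} {x : Fin n → ℂ}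

theorem HasMultiSeries.coeff_eq_taylorCoeff {c : (Fin n →₀ ℕ) → ℂ} {r : ℝ}
    (h : HasMultiSeries f x c r) (hr : 0 < r) : c = taylorCoeff f x := by
  funext T
  rw [taylorCoeff, h.partialMulti_center hr, inv_mul_cancel_left₀ (multiFactorial_ne_zero T)]

theorem eventually_hasMultiSeries_taylorCoeff (hf : AnalyticAt ℂ f x) :
    ∀ᶠ r in 𝓝[>] (0 : ℝ), HasMultiSeries f x (taylorCoeff f x) r := by
  obtain ⟨r, hr, c, h⟩ := exists_hasMultiSeries hf
  filter_upwards [Ioc_mem_nhdsGT hr] with s hs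
  exact h.coeff_eq_taylorCoeff hr ▸ h.mono hs.2

theorem partialWord_eq_partialMulti (hf : AnalyticAt ℂ f x) (w : List (Fin n)) :
    partialWord w f x = partialMulti (wordIndex w) f x := by
  obtain ⟨r, hr, c, h⟩ := exists_hasMultiSeries hf
  rw [(h.partialWord w).apply_center hr, (h.partialMulti _).apply_center hr]

theorem analyticAt_partialMulti (hf : AnalyticAt ℂ f x) (T : Fin n →₀ ℕ) :
    AnalyticAt ℂ (partialMulti T f) x := by
  obtain ⟨r, hr, c, h⟩ := exists_hasMultiSeries hf
  exact (h.partialMulti T).analyticOnNhd x (Metric.mem_ball_self hr)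

theorem partialMulti_add (hf : AnalyticAt ℂ f x) (S T : Fin n →₀ ℕ) :
    partialMulti (S + T) f x = partialMulti S (partialMulti T f) x := by
  obtain ⟨r, hr, c, h⟩ := exists_hasMultiSeries hf
  rw [h.partialMulti_center hr, (h.partialMulti T).partialMulti_center hr,
    mul_inv_cancel_left₀ (multiFactorial_ne_zero S)]

theorem partialMulti_single (hf : AnalyticAt ℂ f x) (i : Fin n) :
    partialMulti (Finsupp.single i 1) f x = partialDeriv i f x := by
  rw [← wordIndex_singleton, ← partialWord_eq_partialMulti hf, partialWord, List.foldr_cons,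
    List.foldr_nil]

theorem partialMulti_eventuallyEq (h : f =ᶠ[𝓝 x] g) (T : Fin n →₀ ℕ) :
    partialMulti T f =ᶠ[𝓝 x] partialMulti T g := by
  rw [partialMulti, partialMulti]
  induction multiWord T with
  | nil => exact h
  | cons i w ih => exact ih.fderiv.mono fun z hz => DFunLike.congr_fun hz (Pi.single i 1)

theorem foldr_partialSet_eq_partialWord (l : List (Finset (Fin n))) :
    ∃ w, wordIndex w = (l.map setIndex).sum ∧ ∀ f, l.foldr partialSet f = partialWord w f := by
  induction l with
  | nil => exact ⟨[], wordIndex_nil, fun _ => rfl⟩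
  | cons I l ih =>
    obtain ⟨w, hw, h⟩ := ih
    refine ⟨multiWord (setIndex I) ++ w, ?_, fun f => ?_⟩
    · rw [wordIndex_append, wordIndex_multiWord, hw, List.map_cons, List.sum_cons]
    · rw [List.foldr_cons, h, partialSet, multiWord_setIndex, partialWord, partialWord,
        partialWord, List.foldr_append]

theorem partialSets_eq_partialMulti (hf : AnalyticAt ℂ f x) {m : ℕ}
    (I : Fin m → Finset (Fin n)) :
    partialSets I f x = partialMulti (∑ j, setIndex (I j)) f x := by
  obtain ⟨w, hw, h⟩ := foldr_partialSet_eq_partialWord (List.ofFn I)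
  rw [partialSets, h, partialWord_eq_partialMulti hf, hw, List.map_ofFn, List.sum_ofFn]
  rfl

theorem partialDeriv_partialSets_eq_partialMulti (hf : AnalyticAt ℂ f x) {m : ℕ}
    (I : Fin m → Finset (Fin n)) (i : Fin n) :
    partialDeriv i (partialSets I f) x =
      partialMulti (∑ j, setIndex (I j) + Finsupp.single i 1) f x := by
  rw [add_comm, partialMulti_add hf, partialMulti_single (analyticAt_partialMulti hf _)]
  have h : partialSets I f =ᶠ[𝓝 x] partialMulti (∑ j, setIndex (I j)) f :=
    hf.eventually_analyticAt.mono fun z hz => partialSets_eq_partialMulti hz I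
  exact DFunLike.congr_fun h.fderiv_eq (Pi.single i 1)

end Analytic

end MultiSeries

section OpenSubset

variable {n : ℕ} {M : Opens (Fin n → ℂ)}

theorem hasMFDerivAt_comp_subtype_val {g : (Fin n → ℂ) → ℂ} {x : M}
    (hg : DifferentiableAt ℂ g x) :
    HasMFDerivAt 𝓘(ℂ, Fin n → ℂ) 𝓘(ℂ) (fun y : M => g y) x
      (fderiv ℂ g (x : Fin n → ℂ)) := by
  refine ⟨hg.continuousAt.comp continuous_subtype_val.continuousAt, ?_⟩
  have hchart : writtenInExtChartAt 𝓘(ℂ, Fin n → ℂ) 𝓘(ℂ) x (fun y : M => g y)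
      =ᶠ[𝓝 (x : Fin n → ℂ)] g :=
    eventually_of_mem (extChartAt_target_mem_nhds (I := 𝓘(ℂ, Fin n → ℂ)) x) fun y hy =>
      congrArg g ((extChartAt 𝓘(ℂ, Fin n → ℂ) x).right_inv hy)
  exact (hg.hasFDerivAt.congr_of_eventuallyEq hchart).hasFDerivWithinAt

variable {f : M → ℂ}

theorem extend_val_comp (f : M → ℂ) :
    (fun y : M => Function.extend Subtype.val f 0 (y : Fin n → ℂ)) = f :=
  Function.extend_comp Subtype.val_injective f 0

theorem analyticAt_extend (hf : ContMDiff 𝓘(ℂ, Fin n → ℂ) 𝓘(ℂ) ω f) (x : M) :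
    AnalyticAt ℂ (Function.extend Subtype.val f 0) x := by
  have h : ContMDiffAt 𝓘(ℂ, Fin n → ℂ) 𝓘(ℂ) ω (Function.extend Subtype.val f 0)
      (x : Fin n → ℂ) := by
    rw [← contMDiffAt_subtype_iff, extend_val_comp]
    exact hf x
  exact h.contDiffAt.analyticAt

theorem partialDeriv_extend (hf : ContMDiff 𝓘(ℂ, Fin n → ℂ) 𝓘(ℂ) ω f) (i : Fin n) (x : M) :
    partialDeriv i (Function.extend Subtype.val f 0) x =
      mfderiv 𝓘(ℂ, Fin n → ℂ) 𝓘(ℂ) f x (coordField i x) := by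
  have h := (hasMFDerivAt_comp_subtype_val (analyticAt_extend hf x).differentiableAt).mfderiv
  rw [extend_val_comp] at h
  rw [h]
  rfl

end OpenSubset

section Antiderivative

variable {n : ℕ}

theorem exists_apply_add_eq {A : Set (Fin n →₀ ℕ)} {g : (Fin n →₀ ℕ) → (Fin n →₀ ℕ) → ℂ}
    (hg : ∀ T ∈ A, ∀ T' ∈ A, ∀ S S', S + T = S' + T' → g S T = g S' T') :
    ∃ a : (Fin n →₀ ℕ) → ℂ, (∀ T ∈ A, ∀ S, a (S + T) = g S T) ∧
      ∀ U, (∀ T ∈ A, ∀ S, U ≠ S + T) → a U = 0 := by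
  let add : (Fin n →₀ ℕ) × A → (Fin n →₀ ℕ) := fun p => p.1 + p.2
  have hfactors : (fun p : (Fin n →₀ ℕ) × A => g p.1 p.2).FactorsThrough add :=
    fun p q h => hg _ p.2.2 _ q.2.2 _ _ h
  refine ⟨Function.extend add (fun p => g p.1 p.2) 0, fun T hT S => ?_, fun U hU => ?_⟩
  · exact hfactors.extend_apply 0 (S, ⟨T, hT⟩)
  · exact Function.extend_apply' _ _ _ fun ⟨p, hp⟩ => hU p.2 p.2.2 p.1 hp.symm

theorem summable_of_summable_add {A : Finset (Fin n →₀ ℕ)} {f : (Fin n →₀ ℕ) → ℂ}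
    (h : ∀ T ∈ A, Summable fun S => f (S + T))
    (h0 : ∀ U, (∀ T ∈ A, ∀ S, U ≠ S + T) → f U = 0) : Summable f := by
  let b (T : Fin n →₀ ℕ) : (Fin n →₀ ℕ) → ℝ := (Set.range (· + T)).indicator fun U => ‖f U‖
  have hb0 (T U : Fin n →₀ ℕ) : 0 ≤ b T U := Set.indicator_nonneg (fun _ _ => norm_nonneg _) U
  have hb_add (T S : Fin n →₀ ℕ) : b T (S + T) = ‖f (S + T)‖ :=
    Set.indicator_of_mem (Set.mem_range_self (f := (· + T)) S) _
  have hb : ∀ T ∈ A, Summable (b T) := fun T hT => by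
    rw [← (add_left_injective T).summable_iff fun U hU => Set.indicator_of_notMem hU _]
    exact (h T hT).norm.congr fun S => (hb_add T S).symm
  refine Summable.of_norm_bounded (summable_sum hb) fun U => ?_
  by_cases hU : ∃ T ∈ A, ∃ S, U = S + T
  · obtain ⟨T, hT, S, rfl⟩ := hU
    rw [← hb_add]
    exact Finset.single_le_sum (fun T' _ => hb0 T' (S + T)) hT
  · push Not at hU
    rw [h0 U hU, norm_zero]
    exact Finset.sum_nonneg fun T _ => hb0 T U

theorem norm_inv_multiFactorial_mul_le_one (S T : Fin n →₀ ℕ) :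
    ‖(multiFactorial (S + T) : ℂ)⁻¹ * multiFactorial S‖ ≤ 1 := by
  have hle : multiFactorial S ≤ multiFactorial (S + T) :=
    Finset.prod_le_prod' fun i _ => Nat.factorial_le (Nat.le_add_right _ _)
  rw [norm_mul, norm_inv, Complex.norm_natCast, Complex.norm_natCast, inv_mul_eq_div]
  exact div_le_one_of_le₀ (Nat.cast_le.2 hle) (Nat.cast_nonneg _)

theorem HasMultiSeries.summable_antiderivative {f : (Fin n → ℂ) → ℂ} {x z : Fin n → ℂ}
    {c : (Fin n →₀ ℕ) → ℂ} {r : ℝ} (h : HasMultiSeries f x c r) (hz : z ∈ Metric.ball x r)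
    (T : Fin n →₀ ℕ) :
    Summable fun S => (multiFactorial (S + T) : ℂ)⁻¹ * (multiFactorial S * c S) *
      multiPow z x (S + T) := by
  refine Summable.of_norm_bounded ((h z hz).summable.norm.mul_right ‖multiPow z x T‖) fun S => ?_
  calc ‖(multiFactorial (S + T) : ℂ)⁻¹ * (multiFactorial S * c S) * multiPow z x (S + T)‖
      = ‖(multiFactorial (S + T) : ℂ)⁻¹ * multiFactorial S‖ *
          (‖c S * multiPow z x S‖ * ‖multiPow z x T‖) := by
        rw [multiPow_add, ← norm_mul, ← norm_mul]
        ring_nf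
    _ ≤ ‖c S * multiPow z x S‖ * ‖multiPow z x T‖ :=
        mul_le_of_le_one_left (by positivity) (norm_inv_multiFactorial_mul_le_one S T)

theorem exists_common_antiderivative {A : Finset (Fin n →₀ ℕ)}
    {f : (Fin n →₀ ℕ) → (Fin n → ℂ) → ℂ} {x : Fin n → ℂ} {r : ℝ}
    (hf : ∀ T ∈ A, HasMultiSeries (f T) x (taylorCoeff (f T) x) r)
    (hcompat : ∀ T ∈ A, ∀ T' ∈ A, ∀ S S', S + T = S' + T' →
      partialMulti S (f T) x = partialMulti S' (f T') x) :
    ∃ (L : (Fin n → ℂ) → ℂ) (a : (Fin n →₀ ℕ) → ℂ), HasMultiSeries L x a r ∧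
      (∀ T ∈ A, ∀ S, a (S + T) = (multiFactorial (S + T) : ℂ)⁻¹ * partialMulti S (f T) x) ∧
      (∀ U, (∀ T ∈ A, ∀ S, U ≠ S + T) → a U = 0) ∧
      ∀ T ∈ A, Set.EqOn (partialMulti T L) (f T) (Metric.ball x r) := by
  obtain ⟨a, ha, ha0⟩ := exists_apply_add_eq (A := A)
    (g := fun S T => (multiFactorial (S + T) : ℂ)⁻¹ * partialMulti S (f T) x)
    fun T hT T' hT' S S' h => by rw [h, hcompat T hT T' hT' S S' h]
  have hL : HasMultiSeries (fun z => ∑' T, a T * multiPow z x T) x a r := fun z hz => by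
    refine (summable_of_summable_add (A := A) (fun T hT => ?_) fun U hU => ?_).hasSum
    · refine ((hf T hT).summable_antiderivative hz T).congr fun S => ?_
      rw [ha T hT, taylorCoeff, mul_inv_cancel_left₀ (multiFactorial_ne_zero S)]
    · rw [ha0 U hU, zero_mul]
  refine ⟨_, a, hL, ha, ha0, fun T hT => ?_⟩
  have hcoeff : (fun S => (multiFactorial S : ℂ)⁻¹ * (multiFactorial (S + T) * a (S + T))) =
      taylorCoeff (f T) x := funext fun S => by
    rw [ha T hT, mul_inv_cancel_left₀ (multiFactorial_ne_zero _), taylorCoeff]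
  exact (hcoeff ▸ hL.partialMulti T).eqOn (hf T hT)

end Antiderivative

section Polynomial

variable {n d : ℕ} {P : MvPolynomial (Fin n) ℂ}

theorem hasMultiSeries_eval (P : MvPolynomial (Fin n) ℂ) (r : ℝ) :
    HasMultiSeries (fun z => MvPolynomial.eval z P) 0 (fun T => P.coeff T) r := by
  intro z _
  simp only [MvPolynomial.eval_eq', multiPow, Pi.zero_apply, sub_zero]
  refine hasSum_sum_of_ne_finset_zero fun T hT => ?_
  rw [MvPolynomial.notMem_support_iff.1 hT, zero_mul]

theorem analyticOnNhd_eval (P : MvPolynomial (Fin n) ℂ) (s : Set (Fin n → ℂ)) :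
    AnalyticOnNhd ℂ (fun z => MvPolynomial.eval z P) s := fun z _ =>
  (hasMultiSeries_eval P (dist z 0 + 1)).analyticOnNhd z (lt_add_one (dist z 0))

theorem partialMulti_eval_of_isHomogeneous (hP : P.IsHomogeneous d) {T : Fin n →₀ ℕ}
    (hT : T.degree = d) (z : Fin n → ℂ) :
    partialMulti T (fun z => MvPolynomial.eval z P) z = multiFactorial T * P.coeff T := by
  have h := (hasMultiSeries_eval P (dist z 0 + 1)).partialMulti T z (lt_add_one (dist z 0))
  have hcoeff : ∀ S ≠ 0, P.coeff (S + T) = 0 := fun S hS => by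
    refine hP.coeff_eq_zero fun hdeg => hS ((Finsupp.degree_eq_zero_iff S).1 ?_)
    rw [map_add, hT] at hdeg
    exact Nat.add_eq_right.1 hdeg
  refine h.unique ?_
  convert hasSum_single (0 : Fin n →₀ ℕ) fun S hS => ?_ using 1
  · beta_reduce
    rw [zero_add, multiFactorial_zero, Nat.cast_one, inv_one, one_mul, multiPow_zero, mul_one]
  · beta_reduce
    rw [hcoeff S hS, mul_zero, mul_zero, zero_mul]

end Polynomial

section Higgs

variable {n : ℕ} {M : Opens (Fin n → ℂ)}
  {K : M → Type*}
  [∀ x, AddCommGroup (K x)] [∀ x, Module ℂ (K x)] [∀ x, TopologicalSpace (K x)]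
  [∀ x, IsTopologicalAddGroup (K x)] [∀ x, ContinuousSMul ℂ (K x)]
  (C : Π x : M, TangentSpace 𝓘(ℂ, Fin n → ℂ) x →L[ℂ] K x →L[ℂ] K x)

theorem higgsWord_cons (i : Fin n) (w : List (Fin n)) (x : M) :
    higgsWord C (i :: w) x = C x (coordField i x) * higgsWord C w x := by
  simp only [higgsWord, List.map_cons, List.prod_cons]

theorem higgsWord_append (v w : List (Fin n)) (x : M) :
    higgsWord C (v ++ w) x = higgsWord C v x * higgsWord C w x := by
  simp only [higgsWord, List.map_append, List.prod_append]

theorem higgsMulti_zero (x : M) : higgsMulti C 0 x = 1 := by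
  simp [higgsMulti, multiWord, higgsWord]

theorem higgsMulti_single (i : Fin n) (x : M) :
    higgsMulti C (Finsupp.single i 1) x = C x (coordField i x) := by
  simp [higgsMulti, multiWord, higgsWord]

theorem higgsSet_eq_higgsMulti (I : Finset (Fin n)) (x : M) :
    higgsSet C I x = higgsMulti C (setIndex I) x := by
  rw [higgsSet, higgsMulti, multiWord_setIndex]

variable {C} {x : M}

theorem higgsWord_perm
    (hC : ∀ X Y : TangentSpace 𝓘(ℂ, Fin n → ℂ) x, C x X * C x Y = C x Y * C x X)
    {v w : List (Fin n)} (h : v.Perm w) :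
    higgsWord C v x = higgsWord C w x :=
  (h.map _).prod_eq' (List.pairwise_map.2 (List.pairwise_of_forall fun _ _ => hC _ _))

theorem higgsMulti_add
    (hC : ∀ X Y : TangentSpace 𝓘(ℂ, Fin n → ℂ) x, C x X * C x Y = C x Y * C x X)
    (S T : Fin n →₀ ℕ) :
    higgsMulti C (S + T) x = higgsMulti C S x * higgsMulti C T x := by
  rw [higgsMulti, higgsMulti, higgsMulti, ← higgsWord_append]
  refine higgsWord_perm hC (Multiset.coe_eq_coe.1 ?_)
  rw [← Multiset.coe_add]
  simp only [multiWord, Multiset.sort_eq, map_add]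

end Higgs

section Transfer

variable {ι A α : Type*} [DecidableEq ι]

theorem apply_eq_apply_single_sum [Fintype ι] [AddCommMonoid A] {f : (ι → A) → α}
    (hf : ∀ R T a b, f (T + Pi.single a R) = f (T + Pi.single b R)) (T : ι → A) (b : ι) :
    f T = f (Pi.single b (∑ a, T a)) := by
  have transfer (t : Finset ι) (U : ι → A) :
      f (U + ∑ a ∈ t, Pi.single a (T a)) = f (U + Pi.single b (∑ a ∈ t, T a)) := by
    induction t using Finset.induction_on generalizing U with
    | empty => simp
    | insert a t ha ih =>
      rw [Finset.sum_insert ha, Finset.sum_insert ha, ← add_assoc, ih, add_right_comm,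
        hf _ _ a b, Pi.single_add, add_assoc, add_comm (Pi.single b _)]
  have h := transfer Finset.univ 0
  rwa [Finset.univ_sum_single T, zero_add, zero_add] at h

theorem apply_add_single_congr {σ : Type*} {f : (ι → σ →₀ ℕ) → α}
    (hf : ∀ i (T : ι → σ →₀ ℕ) (a b : ι), f (T + Pi.single a (Finsupp.single i 1)) =
      f (T + Pi.single b (Finsupp.single i 1)))
    (R : σ →₀ ℕ) (T : ι → σ →₀ ℕ) (a b : ι) :
    f (T + Pi.single a R) = f (T + Pi.single b R) := by
  induction R using Finsupp.induction_linear generalizing T with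
  | zero => simp only [Pi.single_zero]
  | add R R' ih ih' =>
    rw [Pi.single_add, ← add_assoc, ih', add_right_comm, ih, add_right_comm, add_assoc,
      ← Pi.single_add]
  | single i c =>
    induction c generalizing T with
    | zero => simp only [Finsupp.single_zero, Pi.single_zero]
    | succ c ih =>
      rw [Finsupp.single_add, Pi.single_add, ← add_assoc, hf i _ a b, add_right_comm, ih,
        add_right_comm, add_assoc, ← Pi.single_add]

end Transfer

namespace FrobeniusLikeStructure

variable {n k m : ℕ} {M : Opens (Fin n → ℂ)}
  {F : Type*} [NormedAddCommGroup F] [NormedSpace ℂ F]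
  {K : M → Type*} [TopologicalSpace (TotalSpace F K)]
  [∀ x, AddCommGroup (K x)] [∀ x, Module ℂ (K x)] [∀ x, TopologicalSpace (K x)]
  [∀ x, IsTopologicalAddGroup (K x)] [∀ x, ContinuousSMul ℂ (K x)]
  [FiberBundle F K] [VectorBundle ℂ F K]
  (D : FrobeniusLikeStructure k m M F K)

theorem higgsMulti_add_single_apply (T : Fin n →₀ ℕ) (i : Fin n) (x : M) (v : K x) :
    higgsMulti D.C (T + Finsupp.single i 1) x v =
      D.C x (coordField i x) (higgsMulti D.C T x v) := by
  rw [add_comm, higgsMulti_add (D.C_comm x), higgsMulti_single]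
  rfl

theorem S_higgsMulti (x : M) (T : Fin m → Fin n →₀ ℕ) (s : Fin m → K x) (b : Fin m) :
    D.S x (fun a => higgsMulti D.C (T a) x (s a)) =
      D.S x fun a =>
        higgsMulti D.C ((Pi.single b (∑ a, T a) : Fin m → Fin n →₀ ℕ) a) x (s a) := by
  let f (T : Fin m → Fin n →₀ ℕ) : ℂ := D.S x fun a => higgsMulti D.C (T a) x (s a)
  have hupdate (i : Fin n) (T : Fin m → Fin n →₀ ℕ) (c : Fin m) :
      f (T + Pi.single c (Finsupp.single i 1)) =
        D.S x (Function.update (fun a => higgsMulti D.C (T a) x (s a)) c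
          (D.C x (coordField i x) (higgsMulti D.C (T c) x (s c)))) := by
    refine congrArg (D.S x) (Function.eq_update_iff.2 ⟨?_, fun a ha => ?_⟩)
    · rw [Pi.add_apply, Pi.single_eq_same, higgsMulti_add_single_apply]
    · rw [Pi.add_apply, Pi.single_eq_of_ne ha, add_zero]
  have hf (i : Fin n) (T : Fin m → Fin n →₀ ℕ) (a b : Fin m) :
      f (T + Pi.single a (Finsupp.single i 1)) = f (T + Pi.single b (Finsupp.single i 1)) := by
    rw [hupdate, hupdate]
    exact D.S_higgs x (coordField i x) (fun a => higgsMulti D.C (T a) x (s a)) a b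
  exact apply_eq_apply_single_sum (apply_add_single_congr hf) T b

theorem isHolSectionOn_higgsMulti (T : Fin n →₀ ℕ) :
    IsHolSectionOn F (fun x => higgsMulti D.C T x (D.ζ x)) ((⊤ : Opens M) : Set M) := by
  have hword (w : List (Fin n)) :
      IsHolSectionOn F (fun x => higgsWord D.C w x (D.ζ x)) ((⊤ : Opens M) : Set M) := by
    induction w with
    | nil => exact D.ζ_hol
    | cons i w ih =>
      simp only [higgsWord_cons]
      exact D.C_hol ⊤ _ ih i
  exact hword (multiWord T)

theorem mfderiv_S_of_covCoord_eq_zero {σ : Fin m → Π x : M, K x}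
    (hσ : ∀ a, IsHolSectionOn F (σ a) ((⊤ : Opens M) : Set M)) {i : Fin n} {x : M} {b : Fin m}
    (h : ∀ a ≠ b, covCoord D.conn i (σ a) x = 0) :
    mfderiv 𝓘(ℂ, Fin n → ℂ) 𝓘(ℂ) (fun y => D.S y fun a => σ a y) x (coordField i x) =
      D.S x (Function.update (fun a => σ a x) b (covCoord D.conn i (σ b) x)) := by
  refine (D.S_flat ⊤ σ hσ i x trivial).trans (Fintype.sum_eq_single b fun a ha => ?_)
  rw [h a ha]
  exact (D.S x).map_update_zero _ a

theorem covCoord_higgsMulti_setIndex {I : Finset (Fin n)}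
    (hI : D.matroid.IsBase (I : Set (Fin n))) (i : Fin n) (x : M) :
    covCoord D.conn i (fun y => higgsMulti D.C (setIndex I) y (D.ζ y)) x = 0 := by
  simp only [← higgsSet_eq_higgsMulti]
  rw [covCoord, D.flat_base I hI x]
  rfl

theorem covCoord_higgsMulti_setIndex_add_single {I : Finset (Fin n)}
    (hI : D.matroid.IsBase (I : Set (Fin n))) (i j : Fin n) (x : M) :
    covCoord D.conn i
        (fun y => higgsMulti D.C (setIndex I + Finsupp.single j 1) y (D.ζ y)) x =
      covCoord D.conn j
        (fun y => higgsMulti D.C (setIndex I + Finsupp.single i 1) y (D.ζ y)) x := by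
  simpa only [higgsMulti_add_single_apply, D.covCoord_higgsMulti_setIndex hI, map_zero, sub_zero]
    using D.integrable ⊤ _ (D.isHolSectionOn_higgsMulti (setIndex I)) i j x trivial

variable [NeZero m]

theorem matrixElement_sum (T : Fin m → Fin n →₀ ℕ) (x : M) :
    D.matrixElement (∑ a, T a) x = D.S x fun a => higgsMulti D.C (T a) x (D.ζ x) := by
  rw [D.S_higgsMulti x T _ 0, matrixElement]
  congr 1
  refine (Function.eq_update_iff.2 ⟨?_, fun a ha => ?_⟩).symm
  · rw [Pi.single_eq_same]
  · rw [Pi.single_eq_of_ne ha, higgsMulti_zero]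
    rfl

theorem matrixElement_sum_setIndex (I : Fin m → Finset (Fin n)) (x : M) :
    D.matrixElement (∑ j, setIndex (I j)) x =
      D.S x fun j => higgsSet D.C (I j) x (D.ζ x) := by
  simp only [higgsSet_eq_higgsMulti, matrixElement_sum]

theorem matrixElement_sum_add (T : Fin m → Fin n →₀ ℕ) (R : Fin n →₀ ℕ) (x : M) :
    D.matrixElement (∑ a, T a + R) x =
      D.S x fun a => higgsMulti D.C ((T + Pi.single 0 R : Fin m → Fin n →₀ ℕ) a) x (D.ζ x) := by
  rw [← matrixElement_sum]
  simp only [Pi.add_apply, Finset.sum_add_distrib, Fintype.sum_pi_single']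

theorem matrixElement_sum_setIndex_add_single (I : Fin m → Finset (Fin n)) (i : Fin n) (x : M) :
    D.matrixElement (∑ j, setIndex (I j) + Finsupp.single i 1) x =
      D.S x (Function.update (fun j => higgsSet D.C (I j) x (D.ζ x)) 0
        (D.C x (coordField i x) (higgsSet D.C (I 0) x (D.ζ x)))) := by
  rw [matrixElement_sum_add]
  congr 1
  refine Function.eq_update_iff.2 ⟨?_, fun a ha => ?_⟩
  · rw [Pi.add_apply, Pi.single_eq_same, higgsMulti_add_single_apply, higgsSet_eq_higgsMulti]
  · rw [Pi.add_apply, Pi.single_eq_of_ne ha, add_zero, higgsSet_eq_higgsMulti]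

theorem contMDiff_matrixElement (T : Fin n →₀ ℕ) :
    ContMDiff 𝓘(ℂ, Fin n → ℂ) 𝓘(ℂ) ω (D.matrixElement T) := by
  have hT : ∑ a, (Pi.single 0 T : Fin m → Fin n →₀ ℕ) a = T := Fintype.sum_pi_single' _ _
  rw [← hT, funext (D.matrixElement_sum _), ← contMDiffOn_univ]
  exact D.S_hol ⊤ _ fun a => D.isHolSectionOn_higgsMulti _

/-- The matrix element `S(C_T ζ, ζ, …, ζ)`, extended by zero to a function on `ℂⁿ` in order to
differentiate it. -/
def extendedMatrixElement (T : Fin n →₀ ℕ) : (Fin n → ℂ) → ℂ :=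
  Function.extend Subtype.val (D.matrixElement T) 0

theorem extendedMatrixElement_apply (T : Fin n →₀ ℕ) (x : M) :
    D.extendedMatrixElement T x = D.matrixElement T x :=
  Subtype.val_injective.extend_apply _ _ _

theorem analyticAt_extendedMatrixElement (T : Fin n →₀ ℕ) (x : M) :
    AnalyticAt ℂ (D.extendedMatrixElement T) x :=
  analyticAt_extend (D.contMDiff_matrixElement T) x

theorem partialDeriv_extendedMatrixElement_sum_add {T : Fin m → Fin n →₀ ℕ} {i : Fin n} {x : M}
    (h : ∀ a ≠ 0, covCoord D.conn i (fun y => higgsMulti D.C (T a) y (D.ζ y)) x = 0)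
    (R : Fin n →₀ ℕ) :
    partialDeriv i (D.extendedMatrixElement (∑ a, T a + R)) x =
      D.S x (Function.update (fun a => higgsMulti D.C (T a) x (D.ζ x)) 0
        (covCoord D.conn i (fun y => higgsMulti D.C (T 0 + R) y (D.ζ y)) x)) := by
  have hne : ∀ a ≠ 0, (T + Pi.single 0 R : Fin m → Fin n →₀ ℕ) a = T a := fun a ha => by
    rw [Pi.add_apply, Pi.single_eq_of_ne ha, add_zero]
  rw [extendedMatrixElement, partialDeriv_extend (D.contMDiff_matrixElement _),
    funext (D.matrixElement_sum_add T R),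
    D.mfderiv_S_of_covCoord_eq_zero (fun a => D.isHolSectionOn_higgsMulti _)
      fun a ha => by rw [hne a ha, h a ha]]
  congr 1
  refine Function.eq_update_iff.2 ⟨?_, fun a ha => ?_⟩
  · rw [Function.update_self, Pi.add_apply, Pi.single_eq_same]
  · rw [Function.update_of_ne ha, hne a ha]

theorem partialDeriv_extendedMatrixElement_eq_zero {A : Fin n →₀ ℕ}
    (hA : IsStrongSystem D.matroid m 0 A) (i : Fin n) (x : M) :
    partialDeriv i (D.extendedMatrixElement A) x = 0 := by
  obtain ⟨I, hI, rfl⟩ := isStrongSystem_zero_iff.1 hA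
  rw [← add_zero (∑ j, _), D.partialDeriv_extendedMatrixElement_sum_add fun a _ =>
    D.covCoord_higgsMulti_setIndex (hI a) i x, add_zero, D.covCoord_higgsMulti_setIndex (hI 0)]
  exact (D.S x).map_update_zero _ 0

theorem partialDeriv_extendedMatrixElement_add_single_comm {A : Fin n →₀ ℕ}
    (hA : IsStrongSystem D.matroid m 0 A) (i j : Fin n) (x : M) :
    partialDeriv i (D.extendedMatrixElement (A + Finsupp.single j 1)) x =
      partialDeriv j (D.extendedMatrixElement (A + Finsupp.single i 1)) x := by
  obtain ⟨I, hI, rfl⟩ := isStrongSystem_zero_iff.1 hA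
  have hflat (l : Fin n) (a : Fin m) (_ : a ≠ 0) := D.covCoord_higgsMulti_setIndex (hI a) l x
  rw [D.partialDeriv_extendedMatrixElement_sum_add (hflat i),
    D.partialDeriv_extendedMatrixElement_sum_add (hflat j),
    D.covCoord_higgsMulti_setIndex_add_single (hI 0)]

section Compatibility

variable {S S' T T' A : Fin n →₀ ℕ}

theorem partialMulti_extendedMatrixElement_of_add_single {i j : Fin n}
    (hA : IsStrongSystem D.matroid m 0 A)
    (h : S + (A + Finsupp.single i 1) = S' + (A + Finsupp.single j 1)) (x : M) :
    partialMulti S (D.extendedMatrixElement (A + Finsupp.single i 1)) x =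
      partialMulti S' (D.extendedMatrixElement (A + Finsupp.single j 1)) x := by
  rw [add_left_comm, add_left_comm S', add_right_inj] at h
  have han (l : Fin n) := D.analyticAt_extendedMatrixElement (A + Finsupp.single l 1)
  obtain rfl | hij := eq_or_ne i j
  · rw [add_right_cancel h]
  · obtain ⟨R, rfl⟩ : ∃ R, S = R + Finsupp.single j 1 := by
      refine (exists_add_of_le (Finsupp.single_le_iff.2 ?_)).imp fun R hR => hR.trans (add_comm _ _)
      have := DFunLike.congr_fun h j
      simp only [Finsupp.add_apply, Finsupp.single_eq_same, Finsupp.single_eq_of_ne hij.symm,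
        add_zero] at this
      omega
    obtain rfl : S' = R + Finsupp.single i 1 :=
      add_right_cancel (h.symm.trans (add_right_comm _ _ _))
    have hcomm : partialMulti (Finsupp.single j 1)
          (D.extendedMatrixElement (A + Finsupp.single i 1)) =ᶠ[𝓝 (x : Fin n → ℂ)]
        partialMulti (Finsupp.single i 1)
          (D.extendedMatrixElement (A + Finsupp.single j 1)) := by
      refine eventually_of_mem (M.isOpen.mem_nhds x.2) fun y hy => ?_
      rw [partialMulti_single (han i ⟨y, hy⟩), partialMulti_single (han j ⟨y, hy⟩)]
      exact D.partialDeriv_extendedMatrixElement_add_single_comm hA j i ⟨y, hy⟩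
    rw [partialMulti_add (han i x), partialMulti_add (han j x)]
    exact (partialMulti_eventuallyEq hcomm R).eq_of_nhds

theorem partialMulti_extendedMatrixElement_eq (hT : IsStrongSystem D.matroid m 1 T)
    (hT' : IsStrongSystem D.matroid m 1 T') (h : S + T = S' + T') (x : M) :
    partialMulti S (D.extendedMatrixElement T) x =
      partialMulti S' (D.extendedMatrixElement T') x := by
  obtain ⟨A, hA, i, rfl⟩ := isStrongSystem_one_iff.1 hT
  obtain ⟨A', hA', i', rfl⟩ := isStrongSystem_one_iff.1 hT'
  let P (B : Fin n →₀ ℕ) : Prop :=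
    ∀ R j, R + (B + Finsupp.single j 1) = S + (A + Finsupp.single i 1) →
      partialMulti R (D.extendedMatrixElement (B + Finsupp.single j 1)) x =
        partialMulti S (D.extendedMatrixElement (A + Finsupp.single i 1)) x
  have hPA : P A := fun R j hR => D.partialMulti_extendedMatrixElement_of_add_single hA hR x
  have hPA' : P A' := by
    refine (isMConvex_setOf_isStrongSystem_zero D.matroid m).induction
      (T := S + (A + Finsupp.single i 1)) ?_ hA' hA ?_ ?_ hPA
    · intro B hB B' _ u v huv hle hPB' R j hR
      obtain ⟨R', hR'⟩ := exists_add_of_le hle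
      rw [add_comm _ R'] at hR'
      rw [D.partialMulti_extendedMatrixElement_of_add_single hB (hR.trans hR') x, ← huv]
      exact hPB' R' u (by rw [huv, hR'])
    · rw [h]
      exact le_self_add.trans le_add_self
    · exact le_self_add.trans le_add_self
  exact (hPA' S' i' h.symm).symm

end Compatibility

theorem matrixElement_eq_of_isPreconnected {A : Fin n →₀ ℕ}
    (hA : IsStrongSystem D.matroid m 0 A) {U : Set (Fin n → ℂ)} (hU : IsOpen U)
    (hconn : IsPreconnected U) (hUM : U ⊆ M) {x z : M} (hx : (x : Fin n → ℂ) ∈ U)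
    (hz : (z : Fin n → ℂ) ∈ U) : D.matrixElement A z = D.matrixElement A x := by
  have hfderiv (y : M) : fderiv ℂ (D.extendedMatrixElement A) y = 0 :=
    ContinuousLinearMap.coe_injective (LinearMap.pi_ext' fun i => LinearMap.ext_ring
      (D.partialDeriv_extendedMatrixElement_eq_zero hA i y))
  rw [← extendedMatrixElement_apply, ← extendedMatrixElement_apply]
  exact hU.is_const_of_fderiv_eq_zero (𝕜 := ℂ) hconn
    (fun y hy => (D.analyticAt_extendedMatrixElement A ⟨y, hUM hy⟩).differentiableWithinAt)
    (fun y hy => hfderiv ⟨y, hUM hy⟩) hz hx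

section Potentials

variable {U : Opens (Fin n → ℂ)}

theorem isPotentialFirstKind_iff {Q : (Fin n → ℂ) → ℂ} :
    D.IsPotentialFirstKind U Q ↔ AnalyticOnNhd ℂ Q U ∧
      ∀ T, IsStrongSystem D.matroid m 0 T → ∀ z : M, (z : Fin n → ℂ) ∈ U →
        partialMulti T Q z = D.matrixElement T z := by
  refine and_congr_right fun hQ => ⟨?_, fun h I hI z hz => ?_⟩
  · rintro h T hT z hz
    obtain ⟨I, hI, rfl⟩ := isStrongSystem_zero_iff.1 hT
    rw [← partialSets_eq_partialMulti (hQ z hz), matrixElement_sum_setIndex, h I hI z hz]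
  · rw [partialSets_eq_partialMulti (hQ z hz), ← matrixElement_sum_setIndex,
      h _ (isStrongSystem_zero_iff.2 ⟨I, hI, rfl⟩) z hz]

theorem isPotentialSecondKind_iff {L : (Fin n → ℂ) → ℂ} :
    D.IsPotentialSecondKind U L ↔ AnalyticOnNhd ℂ L U ∧
      ∀ T, IsStrongSystem D.matroid m 1 T → ∀ z : M, (z : Fin n → ℂ) ∈ U →
        partialMulti T L z = D.matrixElement T z := by
  refine and_congr_right fun hL => ⟨?_, fun h I hI i z hz => ?_⟩
  · rintro h T hT z hz
    obtain ⟨A, hA, i, rfl⟩ := isStrongSystem_one_iff.1 hT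
    obtain ⟨I, hI, rfl⟩ := isStrongSystem_zero_iff.1 hA
    rw [← partialDeriv_partialSets_eq_partialMulti (hL z hz),
      matrixElement_sum_setIndex_add_single, h I hI i z hz]
  · rw [partialDeriv_partialSets_eq_partialMulti (hL z hz),
      ← matrixElement_sum_setIndex_add_single]
    exact h _ (isStrongSystem_one_iff.2 ⟨_, isStrongSystem_zero_iff.2 ⟨I, hI, rfl⟩, i, rfl⟩) z hz

theorem isHomogeneous_firstKindPolynomial (x : M) :
    (D.firstKindPolynomial x).IsHomogeneous (m * k) := by
  classical
  exact MvPolynomial.IsHomogeneous.sum _ _ _ fun T hT =>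
    MvPolynomial.isHomogeneous_monomial _ ((Finset.mem_filter.1 hT).2.degree_eq D.matroid_rank)

theorem coeff_firstKindPolynomial (x : M) {T : Fin n →₀ ℕ}
    (hT : IsStrongSystem D.matroid m 0 T) :
    (D.firstKindPolynomial x).coeff T = (multiFactorial T : ℂ)⁻¹ * D.matrixElement T x := by
  classical
  have hmem : T ∈ Finset.univ.finsuppAntidiag (m * k) := by
    rw [Finset.mem_finsuppAntidiag]
    refine ⟨?_, Finset.subset_univ _⟩
    rw [← Finsupp.degree_eq_sum, hT.degree_eq D.matroid_rank, add_zero]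
  simp only [firstKindPolynomial, MvPolynomial.coeff_sum, MvPolynomial.coeff_monomial,
    Finset.sum_ite_eq', Finset.mem_filter, hmem, hT, and_self, if_true]

theorem isPotentialFirstKind_firstKindPolynomial (hU : IsPreconnected (U : Set (Fin n → ℂ)))
    (hUM : U ≤ M) {x : M} (hx : (x : Fin n → ℂ) ∈ U) :
    D.IsPotentialFirstKind U fun z => MvPolynomial.eval z (D.firstKindPolynomial x) := by
  refine D.isPotentialFirstKind_iff.2 ⟨analyticOnNhd_eval _ _, fun T hT z hz => ?_⟩
  rw [partialMulti_eval_of_isHomogeneous (D.isHomogeneous_firstKindPolynomial x)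
      (hT.degree_eq D.matroid_rank), D.coeff_firstKindPolynomial x hT,
    mul_inv_cancel_left₀ (multiFactorial_ne_zero T),
    D.matrixElement_eq_of_isPreconnected hT U.isOpen hU hUM hx hz]

theorem exists_isPotentialSecondKind {x : M} {r : ℝ}
    (hU : (U : Set (Fin n → ℂ)) = Metric.ball (x : Fin n → ℂ) r)
    (hseries : ∀ T, IsStrongSystem D.matroid m 1 T → HasMultiSeries (D.extendedMatrixElement T) x
      (taylorCoeff (D.extendedMatrixElement T) x) r) :
    ∃ (L : (Fin n → ℂ) → ℂ) (a : (Fin n →₀ ℕ) → ℂ), D.IsPotentialSecondKind U L ∧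
      (∀ z ∈ U, HasSum (fun T => a T * multiPow z x T) (L z)) ∧
      (∀ T₁ T₂, IsStrongSystem D.matroid m 1 T₂ → a (T₁ + T₂) = D.secondKindCoeff x T₁ T₂) ∧
      ∀ T, (¬ ∃ T₁ T₂, IsStrongSystem D.matroid m 1 T₂ ∧ T = T₁ + T₂) → a T = 0 := by
  have hfin := finite_setOf_isStrongSystem D.matroid_rank m 1
  have hmem {T : Fin n →₀ ℕ} : T ∈ hfin.toFinset ↔ IsStrongSystem D.matroid m 1 T :=
    hfin.mem_toFinset
  obtain ⟨L, a, hL, ha, ha0, hderiv⟩ := exists_common_antiderivative (A := hfin.toFinset)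
    (fun T hT => hseries T (hmem.1 hT)) fun T hT T' hT' S S' h =>
      D.partialMulti_extendedMatrixElement_eq (hmem.1 hT) (hmem.1 hT') h x
  refine ⟨L, a, D.isPotentialSecondKind_iff.2 ⟨hU ▸ hL.analyticOnNhd, fun T hT z hz => ?_⟩,
    fun z hz => hL z (hU ▸ hz), fun T₁ T₂ hT₂ => ha T₂ (hmem.2 hT₂) T₁,
    fun T hT => ha0 T fun T₂ hT₂ T₁ h => hT ⟨T₁, T₂, hmem.1 hT₂, h⟩⟩
  rw [hderiv T (hmem.2 hT) (hU ▸ hz), extendedMatrixElement_apply]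

end Potentials

end FrobeniusLikeStructure

end

theorem theorem1p2_general {n k m : ℕ} [NeZero m] (M : Opens (Fin n → ℂ))
    (F : Type*) [NormedAddCommGroup F] [NormedSpace ℂ F]
    (K : M → Type*) [TopologicalSpace (TotalSpace F K)]
    [∀ x, AddCommGroup (K x)] [∀ x, Module ℂ (K x)] [∀ x, TopologicalSpace (K x)]
    [∀ x, IsTopologicalAddGroup (K x)] [∀ x, ContinuousSMul ℂ (K x)]
    [FiberBundle F K] [VectorBundle ℂ F K]
    (D : FrobeniusLikeStructure k m M F K) (x : M) :
    ∃ U : Opens (Fin n → ℂ), (x : Fin n → ℂ) ∈ U ∧ U ≤ M ∧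
      (∃ Q : (Fin n → ℂ) → ℂ, D.IsPotentialFirstKind U Q ∧
        ∀ z ∈ U, Q z = MvPolynomial.eval z (D.firstKindPolynomial x)) ∧
      (∃ (L : (Fin n → ℂ) → ℂ) (a : (Fin n →₀ ℕ) → ℂ), D.IsPotentialSecondKind U L ∧
        (∀ z ∈ U, HasSum (fun T => a T * multiPow z x T) (L z)) ∧
        (∀ T₁ T₂, IsStrongSystem D.matroid m 1 T₂ → a (T₁ + T₂) = D.secondKindCoeff x T₁ T₂) ∧
        (∀ T, (¬ ∃ T₁ T₂, IsStrongSystem D.matroid m 1 T₂ ∧ T = T₁ + T₂) → a T = 0)) := by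
  have hball : ∀ᶠ r in 𝓝[>] 0, Metric.ball (x : Fin n → ℂ) r ⊆ M :=
    eventually_nhdsWithin_of_eventually_nhds
      (eventually_ball_subset (M.isOpen.mem_nhds x.2))
  have hseries : ∀ᶠ r in 𝓝[>] 0, ∀ T, IsStrongSystem D.matroid m 1 T →
      HasMultiSeries (D.extendedMatrixElement T) x (taylorCoeff (D.extendedMatrixElement T) x) r :=
    (eventually_all_finite (finite_setOf_isStrongSystem D.matroid_rank m 1)).2 fun T _ =>
      eventually_hasMultiSeries_taylorCoeff (D.analyticAt_extendedMatrixElement T x)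
  obtain ⟨r, hr, hrM, hr_series⟩ :=
    (eventually_mem_nhdsWithin.and (hball.and hseries)).exists
  let U : Opens (Fin n → ℂ) := ⟨Metric.ball x r, Metric.isOpen_ball⟩
  have hx : (x : Fin n → ℂ) ∈ U := Metric.mem_ball_self hr
  exact ⟨U, hx, hrM, ⟨_, D.isPotentialFirstKind_firstKindPolynomial
    (convex_ball (x : Fin n → ℂ) r).isPreconnected hrM hx, fun _ _ => rfl⟩,
    D.exists_isPotentialSecondKind rfl hr_series⟩

theorem theorem1p2 {n k m : ℕ} [NeZero n] [NeZero k] [NeZero m] (M : Opens (Fin n → ℂ))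
    (F : Type*) [NormedAddCommGroup F] [NormedSpace ℂ F] [FiniteDimensional ℂ F]
    (K : M → Type*) [TopologicalSpace (TotalSpace F K)]
    [∀ x, AddCommGroup (K x)] [∀ x, Module ℂ (K x)] [∀ x, TopologicalSpace (K x)]
    [∀ x, IsTopologicalAddGroup (K x)] [∀ x, ContinuousSMul ℂ (K x)]
    [FiberBundle F K] [VectorBundle ℂ F K]
    [ContMDiffVectorBundle ω F K 𝓘(ℂ, Fin n → ℂ)]
    (D : FrobeniusLikeStructure k m M F K) (x : M) :
    ∃ U : Opens (Fin n → ℂ), (x : Fin n → ℂ) ∈ U ∧ U ≤ M ∧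
      (∃ Q : (Fin n → ℂ) → ℂ, D.IsPotentialFirstKind U Q ∧
        ∀ z ∈ U, Q z = MvPolynomial.eval z (D.firstKindPolynomial x)) ∧
      (∃ (L : (Fin n → ℂ) → ℂ) (a : (Fin n →₀ ℕ) → ℂ), D.IsPotentialSecondKind U L ∧
        (∀ z ∈ U, HasSum (fun T => a T * multiPow z x T) (L z)) ∧
        (∀ T₁ T₂, IsStrongSystem D.matroid m 1 T₂ → a (T₁ + T₂) = D.secondKindCoeff x T₁ T₂) ∧
        (∀ T, (¬ ∃ T₁ T₂, IsStrongSystem D.matroid m 1 T₂ ∧ T = T₁ + T₂) → a T = 0)) :=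
  theorem1p2_general M F K D x
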